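/- Let $\mathbb D$ be the open unit disc and $H(\mathbb D)$ the space of analytic functions on $\mathbb D$. A \emph{normal weight} is a strictly positive, continuous function $\nu$ on $\mathbb D$ with $\nu(z)=\nu(|z|)$, non-increasing in $|z|$, such that $r\mapsto \nu(r)/(1-r^2)^{\beta}$ is almost increasing on $[0,1)$ for some $\beta>0$ and $r\mapsto\nu(r)/(1-r^2)^{\gamma}$ is almost decreasing on $[0,1)$ for some $\gamma>0$ (monotone up to a multiplicative constant). For a weight $w$ put $$\mathcal H^\infty_w=\Big\{f\in H(\mathbb D):\|f\|=\sup_{z\in\mathbb D}w(z)|f(z)|<\infty\Big\},\qquad \mathcal H^0_w=\Big\{f\in H(\mathbb D):\lim_{|z|\to1^-}w(z)|f(z)|=0\Big\},$$ both with the norm of $\mathcal H^\infty_w$. For $g\in H(\mathbb D)$ and an analytic self-map $\phi$ of $\mathbb D$ let $$(S_g^\phi f)(z)=\int_0^z f'(\phi(\zeta))\,g(\zeta)\,d\zeta,\qquad f\in H(\mathbb D),\ z\in\mathbb D.$$ Let $\nu,\mu$ be normal weights, $g\in H(\mathbb D)$, and $\phi$ an analytic self-map of $\mathbb D$ such that $S_g^\phi:\mathcal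 H^0_\nu\to\mathcal H^\infty_\mu$ is bounded. Then there are (unique) topological isomorphisms $\Phi_\nu:\mathcal H^\infty_\nu\to(\mathcal H^0_\nu)''$ and $\Phi_\mu:\mathcal H^\infty_\mu\to(\mathcal H^0_\mu)''$ with $\langle\Phi_\nu f,\delta_z\rangle=f(z)$ and $\langle\Phi_\mu f,\delta_z\rangle=f(z)$ for all $f$ and all $z\in\mathbb D$, where $\delta_z$ is evaluation at $z$; and, with $J:\mathcal H^\infty_\mu\to(\mathcal H^\infty_\mu)''$ the canonical embedding, the following hold. (i) The following are equivalent: (a) $S_g^\phi:\mathcal H^0_\nu\to\mathcal H^\infty_\mu$ is compact; (b) $S_g^\phi:\mathcal H^0_\nu\to\mathcal H^\infty_\mu$ is weakly compact; (c) the bi-transpose of $S_g^\phi:\mathcal H^0_\nu\to\mathcal H^\infty_\mu$ satisfies $(S_g^\phi)''=S_g^\phi$, that is, for every $f\in\mathcal H^\infty_\nu$ one has $S_g^\phi f\in\mathcal H^\infty_\mu$ and $(S_g^\phi)''(\Phi_\nu f)=J(S_g^\phi f)$. (ii) If $g\in\mathcal H^0_{(1-|z|^2)\mu(z)}$, then $S_g^\phi:\mathcal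 H^0_\nu\to\mathcal H^0_\mu$ is bounded and its bi-transpose satisfies $(S_g^\phi)''=S_g^\phi$, that is, for every $f\in\mathcal H^\infty_\nu$ one has $S_g^\phi f\in\mathcal H^\infty_\mu$ and $(S_g^\phi)''(\Phi_\nu f)=\Phi_\mu(S_g^\phi f)$. Moreover, $S_g^\phi:\mathcal H^0_\nu\to\mathcal H^0_\mu$ is compact if and only if $S_g^\phi(\mathcal H^\infty_\nu)\subset\mathcal H^0_\mu$. -/

import Mathlib

open Set Filter Topology Metric

noncomputable section

namespace VolterraComp

/-- The open unit disc `𝔻` of the complex plane. -/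
abbrev disc : Set ℂ := ball (0 : ℂ) 1

/-- `h` is almost increasing on `[0,1)`: `h r ≤ C h s` whenever `r ≤ s`. -/
def AlmostIncreasing (h : ℝ → ℝ) : Prop :=
  ∃ C : ℝ, 0 < C ∧ ∀ r s : ℝ, 0 ≤ r → r ≤ s → s < 1 → h r ≤ C * h s

/-- `h` is almost decreasing on `[0,1)`: `h s ≤ C h r` whenever `r ≤ s`. -/
def AlmostDecreasing (h : ℝ → ℝ) : Prop :=
  ∃ C : ℝ, 0 < C ∧ ∀ r s : ℝ, 0 ≤ r → r ≤ s → s < 1 → h s ≤ C * h r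

/-- Normal weights on the disc (in the sense of Shields and Williams).  Only the values on the
disc matter. -/
structure NormalWeight where
  toFun : ℂ → ℝ
  pos : ∀ z ∈ disc, 0 < toFun z
  continuousOn : ContinuousOn toFun disc
  radial : ∀ z ∈ disc, toFun z = toFun ((‖z‖ : ℝ) : ℂ)
  nonincreasing : ∀ r s : ℝ, 0 ≤ r → r ≤ s → s < 1 → toFun (s : ℂ) ≤ toFun (r : ℂ)
  normal_I : ∃ β : ℝ, 0 < β ∧ AlmostIncreasing (fun r => toFun (r : ℂ) / (1 - r ^ 2) ^ β)
  normal_II : ∃ γ : ℝ, 0 < γ ∧ AlmostDecreasing (fun r => toFun (r : ℂ) / (1 - r ^ 2) ^ γ)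

instance : CoeFun NormalWeight (fun _ => ℂ → ℝ) := ⟨NormalWeight.toFun⟩

/-- `f` is analytic on the disc and `sup_{z ∈ 𝔻} w(z)|f(z)| < ∞`. -/
def MemHinf (w : ℂ → ℝ) (f : ℂ → ℂ) : Prop :=
  DifferentiableOn ℂ f disc ∧ BddAbove (range fun z : disc => w z * ‖f z‖)

/-- `w(z)|f(z)| → 0` as `|z| → 1⁻`. -/
def VanishesAtBoundary (w : ℂ → ℝ) (f : ℂ → ℂ) : Prop :=
  Tendsto (fun z : ℂ => w z * ‖f z‖) (comap (fun z : ℂ => ‖z‖) (𝓝[<] 1)) (𝓝 0)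

/-- `f` is analytic on the disc and `w(z)|f(z)| → 0` as `|z| → 1⁻`. -/
def MemH0 (w : ℂ → ℝ) (f : ℂ → ℂ) : Prop :=
  DifferentiableOn ℂ f disc ∧ VanishesAtBoundary w f

/-- The vector space underlying `H^∞_ν`.  A function on the disc is represented by its extension
by zero to `ℂ`, so that two elements are equal iff they agree on the disc. -/
def HinfSubmodule (ν : NormalWeight) : Submodule ℂ (ℂ → ℂ) where
  carrier := {f | MemHinf ν f ∧ ∀ z ∉ disc, f z = 0}
  zero_mem' := by
    refine ⟨⟨differentiableOn_const 0, 0, ?_⟩, fun _ _ => rfl⟩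
    rintro _ ⟨z, rfl⟩
    simp
  add_mem' := by
    rintro f g ⟨⟨hf, A, hA⟩, hf0⟩ ⟨⟨hg, B, hB⟩, hg0⟩
    refine ⟨⟨hf.add hg, A + B, ?_⟩, fun z hz => by simp [hf0 z hz, hg0 z hz]⟩
    rintro _ ⟨z, rfl⟩
    have h1 := hA (mem_range_self z)
    have h2 := hB (mem_range_self z)
    have h3 := mul_le_mul_of_nonneg_left (norm_add_le (f z) (g z)) (ν.pos z z.2).le
    simp only [Pi.add_apply] at *
    linarith
  smul_mem' := by
    rintro c f ⟨⟨hf, A, hA⟩, hf0⟩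
    refine ⟨⟨hf.const_smul c, ‖c‖ * A, ?_⟩, fun z hz => by simp [hf0 z hz]⟩
    rintro _ ⟨z, rfl⟩
    have h1 := mul_le_mul_of_nonneg_left (hA (mem_range_self z)) (norm_nonneg c)
    simp only [Pi.smul_apply, norm_smul] at *
    linarith

/-- The weighted space `H^∞_ν`.  (A separate type, so that it carries the weighted sup norm and not
the topology of pointwise convergence.) -/
def Hinf (ν : NormalWeight) : Type := HinfSubmodule ν

variable {ν : NormalWeight}

instance : AddCommGroup (Hinf ν) := inferInstanceAs (AddCommGroup (HinfSubmodule ν))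

instance : Module ℂ (Hinf ν) := inferInstanceAs (Module ℂ (HinfSubmodule ν))

instance : CoeFun (Hinf ν) (fun _ => ℂ → ℂ) := ⟨fun f => f.1⟩

theorem Hinf.zero_apply (z : ℂ) : (0 : Hinf ν) z = 0 := rfl

theorem Hinf.add_apply (f g : Hinf ν) (z : ℂ) : (f + g) z = f z + g z := rfl

theorem Hinf.neg_apply (f : Hinf ν) (z : ℂ) : (-f) z = - f z := rfl

theorem Hinf.smul_apply (c : ℂ) (f : Hinf ν) (z : ℂ) : (c • f) z = c * f z := rfl

theorem Hinf.ext {f g : Hinf ν} (h : ∀ z ∈ disc, f z = g z) : f = g := by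
  refine Subtype.ext (funext fun z => ?_)
  by_cases hz : z ∈ disc
  · exact h z hz
  · exact (f.2.2 z hz).trans (g.2.2 z hz).symm

/-- The norm `‖f‖ = sup_{z ∈ 𝔻} ν(z)|f(z)|`. -/
instance : Norm (Hinf ν) := ⟨fun f => ⨆ z : disc, ν z * ‖f z‖⟩

theorem Hinf.norm_def (f : Hinf ν) : ‖f‖ = ⨆ z : disc, ν z * ‖f z‖ := rfl

theorem Hinf.le_norm (f : Hinf ν) {z : ℂ} (hz : z ∈ disc) : ν z * ‖f z‖ ≤ ‖f‖ :=
  le_ciSup f.2.1.2 (⟨z, hz⟩ : disc)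

instance : Nonempty disc := ⟨⟨0, by simp⟩⟩

theorem Hinf.norm_le {f : Hinf ν} {C : ℝ} (h : ∀ z ∈ disc, ν z * ‖f z‖ ≤ C) : ‖f‖ ≤ C :=
  ciSup_le fun z : disc => h z z.2

theorem Hinf.norm_nonneg' (f : Hinf ν) : 0 ≤ ‖f‖ :=
  (mul_nonneg (ν.pos 0 (by simp)).le (norm_nonneg _)).trans (f.le_norm (z := 0) (by simp))

instance : NormedAddCommGroup (Hinf ν) :=
  AddGroupNorm.toNormedAddCommGroup
    { toFun := fun f => ‖f‖
      map_zero' := le_antisymm (Hinf.norm_le fun z _ => by simp [Hinf.zero_apply])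
        (Hinf.norm_nonneg' _)
      add_le' := fun f g => Hinf.norm_le fun z hz => by
        have h1 := f.le_norm hz
        have h2 := g.le_norm hz
        have h3 := mul_le_mul_of_nonneg_left (norm_add_le (f z) (g z)) (ν.pos z hz).le
        rw [Hinf.add_apply]
        linarith
      neg' := fun f => by simp [Hinf.norm_def, Hinf.neg_apply]
      eq_zero_of_map_eq_zero' := fun f hf => Hinf.ext fun z hz => by
        have h1 := f.le_norm hz
        have h2 : ‖f‖ = 0 := hf
        have h3 := ν.pos z hz
        rw [h2] at h1
        have h4 : ‖f z‖ ≤ 0 := by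
          by_contra! h
          exact absurd h1 (not_le.mpr (mul_pos h3 h))
        rw [Hinf.zero_apply]
        exact norm_le_zero_iff.mp h4 }

instance : NormedSpace ℂ (Hinf ν) where
  norm_smul_le := fun c f => Hinf.norm_le fun z hz => by
    have h1 := mul_le_mul_of_nonneg_left (f.le_norm hz) (norm_nonneg c)
    rw [Hinf.smul_apply, norm_mul]
    linarith

/-- The little weighted space `H^0_ν`, with the norm of `H^∞_ν`. -/
def H0 (ν : NormalWeight) : Submodule ℂ (Hinf ν) where
  carrier := {f | VanishesAtBoundary ν f}
  zero_mem' := by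
    simp only [mem_ofPred_eq, VanishesAtBoundary, Hinf.zero_apply, norm_zero, mul_zero]
    exact tendsto_const_nhds
  add_mem' := by
    intro f g hf hg
    have h : Tendsto (fun z : ℂ => ν z * ‖f z‖ + ν z * ‖g z‖)
        (comap (fun z : ℂ => ‖z‖) (𝓝[<] 1)) (𝓝 0) := by simpa using hf.add hg
    have hev : ∀ᶠ z : ℂ in comap (fun z : ℂ => ‖z‖) (𝓝[<] 1), z ∈ disc := by
      refine eventually_comap.mpr ?_
      filter_upwards [self_mem_nhdsWithin] with r hr z hz
      simpa [hz] using hr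
    refine squeeze_zero' ?_ ?_ h
    · filter_upwards [hev] with z hz
      exact mul_nonneg (ν.pos z hz).le (norm_nonneg _)
    · filter_upwards [hev] with z hz
      rw [← mul_add, Hinf.add_apply]
      exact mul_le_mul_of_nonneg_left (norm_add_le _ _) (ν.pos z hz).le
  smul_mem' := by
    intro c f hf
    have h := Tendsto.const_mul ‖c‖ (show Tendsto _ _ _ from hf)
    rw [mul_zero] at h
    refine h.congr fun z => ?_
    rw [Hinf.smul_apply, norm_mul]
    ring

/-- The point evaluation `δ_z : f ↦ f(z)` as a bounded functional on `H^0_ν`. -/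
def pointEval (ν : NormalWeight) (z : disc) : StrongDual ℂ (H0 ν) :=
  LinearMap.mkContinuous
    { toFun := fun f : H0 ν => (f : Hinf ν) (z : ℂ)
      map_add' := fun _ _ => rfl
      map_smul' := fun _ _ => rfl }
    (ν z)⁻¹
    (fun f => by
      have h1 := (f : Hinf ν).le_norm z.2
      rw [inv_mul_eq_div, le_div_iff₀ (ν.pos z z.2), mul_comm]
      exact h1)

/-- The Volterra composition operator `(S_g^φ f)(z) = ∫_0^z f'(φ(ζ)) g(ζ) dζ`, the integral being
taken along the segment from `0` to `z`. -/
def volterraS (g φ f : ℂ → ℂ) (z : ℂ) : ℂ :=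
  ∫ t in (0 : ℝ)..1, z * (deriv f (φ (t * z)) * g (t * z))

section Operators

variable {E F : Type*} [NormedAddCommGroup E] [NormedSpace ℂ E]
  [NormedAddCommGroup F] [NormedSpace ℂ F]

/-- The transpose `T' : F' → E'`, `ℓ ↦ ℓ ∘ T`. -/
def transpose (T : E →L[ℂ] F) : StrongDual ℂ F →L[ℂ] StrongDual ℂ E :=
  (ContinuousLinearMap.compL ℂ E F ℂ).flip T

/-- The bi-transpose `T'' : E'' → F''`. -/
def bitranspose (T : E →L[ℂ] F) :
    StrongDual ℂ (StrongDual ℂ E) →L[ℂ] StrongDual ℂ (StrongDual ℂ F) :=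
  transpose (transpose T)

/-- `T` is weakly compact: the image of the closed unit ball is relatively compact in the weak
topology. -/
def IsWeaklyCompactOperator (T : E →L[ℂ] F) : Prop :=
  IsCompact (closure (toWeakSpace ℂ F '' (T '' closedBall (0 : E) 1)))

end Operators

/-- `Φ` is the canonical identification of `H^∞_ν` with the bidual of `H^0_ν`, i.e. the one with
`⟨Φ f, δ_z⟩ = f(z)`.  As `Φ` is onto, there is at most one such `Φ`. -/
def IsCanonicalBidual (Φ : Hinf ν ≃L[ℂ] StrongDual ℂ (StrongDual ℂ (H0 ν))) : Prop :=
  ∀ (f : Hinf ν) (z : disc), Φ f (pointEval ν z) = f z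

end VolterraComp

end

/-! Everything rests on the dilations $D_r f=f(r\,\cdot)$. By Cauchy estimates $D_r$ is an
operator-norm limit of finite rank operators on $H^0_\nu$, hence compact. The main claim is that
$TD_r\to T$ in norm as $r\to1$ along the radii $1-1/(n+2)$ for every weakly compact $T$ on
$H^0_\nu$; a weakly compact $T$ into a Banach space is then compact.

To prove it, test $TD_{r_n}-T$ on almost norming unit vectors $f_n$. The functions $f_n-D_{r_n}f_n$
are bounded and tend to $0$ locally uniformly. Since each lies in $H^0_\nu$, a gliding hump argument
(`IsLocallyUniformlyNull.exists_isWeaklyUnconditionallyBounded`) extracts a $c_0$-like subsequence,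
and a weakly compact operator cannot be bounded below on such a sequence
(`IsWeaklyUnconditionallyBounded.not_forall_le_norm`, by Rosenthal's lemma and a double limit
argument).

Applied to functionals, the claim gives $\ell\circ D_{r_n}\to\ell$ in norm. So the point evaluations
are total for the bidual, and $f\mapsto\lim_n\ell(D_{r_n}f)$ identifies $H^\infty_\nu$ isometrically
with $(H^0_\nu)''$. Bi-transposes are thus computed as limits of $S(D_{r_n}f)$, which converge
pointwise to $S_g^\phi f$. Statement (c) then says that $S''$ takes values in the canonical copy of
$H^\infty_\mu$, which forces weak compactness. In (ii), the condition on $g$ puts $S(D_{r_n}f)$ in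
the closed subspace $H^0_\mu$. -/

namespace VolterraComp

/-! ### Disjointification of nonnegative matrices -/

/-- **Rosenthal's lemma** for nonnegative matrices with bounded row sums: along some infinite set
of indices the off-diagonal row sums are small. -/
theorem exists_injective_sum_erase_le {ε : ℝ} (hε : 0 < ε) (m : ℕ) (a : ℕ → ℕ → ℝ)
    (ha : ∀ j k, 0 ≤ a j k) (hsum : ∀ j (s : Finset ℕ), ∑ k ∈ s, a j k ≤ m * ε) :
    ∃ σ : ℕ → ℕ, Function.Injective σ ∧
      ∀ j (s : Finset ℕ), ∑ k ∈ s.erase j, a (σ j) (σ k) ≤ ε := by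
  induction m generalizing a with
  | zero =>
    refine ⟨id, Function.injective_id, fun j s => (hsum _ _).trans ?_⟩
    simpa using hε.le
  | succ m ih =>
    -- The pairing splits `ℕ` into infinitely many infinite blocks. Either one block already works,
    -- or every block `p` has a row `q p` whose off-diagonal mass inside the block exceeds `ε`.
    by_cases h : ∃ p, ∀ q (s : Finset ℕ), ∑ k ∈ s.erase q, a (Nat.pair p q) (Nat.pair p k) ≤ ε
    · obtain ⟨p, hp⟩ := h
      exact ⟨Nat.pair p, fun x y hxy => (Nat.pair_eq_pair.mp hxy).2, hp⟩
    · push Not at h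
      choose q s hqs using h
      have hinj : Function.Injective fun p => Nat.pair p (q p) :=
        fun x y hxy => (Nat.pair_eq_pair.mp hxy).1
      -- Keep one index `q p` per block. The columns carrying the excess mass of row `q p` are all
      -- discarded, so each remaining row sum drops by `ε` and the induction hypothesis applies.
      obtain ⟨τ, hτ, hτs⟩ := ih (fun i j => a (Nat.pair i (q i)) (Nat.pair j (q j)))
        (fun _ _ => ha _ _) (fun p t => by
          have hdisj : Disjoint (t.image fun p => Nat.pair p (q p))
              (((s p).erase (q p)).image (Nat.pair p)) := by
            rw [Finset.disjoint_left]
            intro x hx hx'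
            obtain ⟨i, -, rfl⟩ := Finset.mem_image.mp hx
            obtain ⟨k, hk, hk'⟩ := Finset.mem_image.mp hx'
            obtain ⟨rfl, rfl⟩ := Nat.pair_eq_pair.mp hk'
            simp at hk
          have h1 := hsum (Nat.pair p (q p))
            ((t.image fun p => Nat.pair p (q p)) ∪ (((s p).erase (q p)).image (Nat.pair p)))
          rw [Finset.sum_union hdisj, Finset.sum_image (fun x _ y _ hxy => hinj hxy),
            Finset.sum_image (fun x _ y _ hxy => (Nat.pair_eq_pair.mp hxy).2)] at h1
          have h2 := hqs p
          push_cast at h1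
          linarith)
      exact ⟨fun p => Nat.pair (τ p) (q (τ p)), hinj.comp hτ, hτs⟩

/-! ### Weakly compact operators on normed spaces -/

section Abstract

variable {E F : Type*} [NormedAddCommGroup E] [NormedSpace ℂ E]
  [NormedAddCommGroup F] [NormedSpace ℂ F]

theorem transpose_apply (T : E →L[ℂ] F) (l : StrongDual ℂ F) (x : E) :
    transpose T l x = l (T x) := rfl

theorem bitranspose_apply (T : E →L[ℂ] F) (x : StrongDual ℂ (StrongDual ℂ E))
    (l : StrongDual ℂ F) : bitranspose T x l = x (transpose T l) := rfl

theorem isWeaklyCompactOperator_of_isCompactOperator {T : E →L[ℂ] F} (hT : IsCompactOperator T) :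
    IsWeaklyCompactOperator T := by
  obtain ⟨K, hK, hTK⟩ := IsCompactOperator.image_closedBall_subset_compact
    (f := (T : E →ₗ[ℂ] F)) hT 1
  have hK' : IsCompact (toWeakSpace ℂ F '' K) := hK.image (toWeakSpaceCLM ℂ F).continuous
  exact hK'.of_isClosed_subset isClosed_closure
    (closure_minimal (image_mono hTK) hK'.isClosed)

/-- One half of Gantmacher's theorem. The bi-transpose is weak-star continuous, so it maps the
weak-star compact unit ball onto a weak-star compact set. This set lies in the copy of `F`, on which
the weak-star topology is the weak topology of `F`. -/
theorem isWeaklyCompactOperator_of_bitranspose_mem_range {T : E →L[ℂ] F}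
    (hT : ∀ x, bitranspose T x ∈ range (NormedSpace.inclusionInDoubleDual ℂ F)) :
    IsWeaklyCompactOperator T := by
  let B : Set (WeakDual ℂ (StrongDual ℂ E)) :=
    WeakDual.toStrongDual ⁻¹' closedBall (0 : StrongDual ℂ (StrongDual ℂ E)) 1
  let A : WeakDual ℂ (StrongDual ℂ E) → WeakDual ℂ (StrongDual ℂ F) :=
    fun x => StrongDual.toWeakDual (bitranspose T (WeakDual.toStrongDual x))
  have hA : Continuous A := WeakDual.continuous_of_continuous_eval fun l =>
    WeakDual.eval_continuous (transpose T l)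
  have hB : IsCompact (A '' B) := (WeakDual.isCompact_closedBall _ _).image hA
  have hJ := NormedSpace.isEmbedding_inclusionInDoubleDualWeak ℂ F
  have hsub : A '' B ⊆ range (NormedSpace.inclusionInDoubleDualWeak ℂ F) := by
    rintro _ ⟨x, -, rfl⟩
    obtain ⟨y, hy⟩ := hT (WeakDual.toStrongDual x)
    exact ⟨toWeakSpace ℂ F y, congrArg StrongDual.toWeakDual hy⟩
  have hK := (hJ.isInducing.isCompact_preimage_iff hsub).mpr hB
  refine hK.of_isClosed_subset isClosed_closure (closure_minimal ?_ hK.isClosed)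
  rintro _ ⟨_, ⟨x, hx, rfl⟩, rfl⟩
  refine ⟨StrongDual.toWeakDual (NormedSpace.inclusionInDoubleDual ℂ E x), ?_, rfl⟩
  have h1 := NormedSpace.double_dual_bound ℂ E x
  simp only [mem_closedBall_zero_iff] at hx
  have h2 : NormedSpace.inclusionInDoubleDual ℂ E x ∈
      closedBall (0 : StrongDual ℂ (StrongDual ℂ E)) 1 :=
    (mem_closedBall_zero_iff (E := StrongDual ℂ (StrongDual ℂ E))).mpr (h1.trans hx)
  exact h2

/-- The finite sums `∑ c_k u_k` with `|c_k| ≤ 1` are uniformly bounded. -/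
def IsWeaklyUnconditionallyBounded (u : ℕ → E) (C : ℝ) : Prop :=
  ∀ (s : Finset ℕ) (c : ℕ → ℂ), (∀ k, ‖c k‖ ≤ 1) → ‖∑ k ∈ s, c k • u k‖ ≤ C

/-- Choose the coefficients `c k` to cancel the phases of `l (u k)`. -/
theorem IsWeaklyUnconditionallyBounded.sum_norm_apply_le {u : ℕ → E} {C : ℝ}
    (hu : IsWeaklyUnconditionallyBounded u C) (l : StrongDual ℂ E) (s : Finset ℕ) :
    ∑ k ∈ s, ‖l (u k)‖ ≤ ‖l‖ * C := by
  have hc : ∀ k, ∃ c : ℂ, ‖c‖ ≤ 1 ∧ c * l (u k) = ‖l (u k)‖ := fun k => by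
    by_cases h : l (u k) = 0
    · exact ⟨0, by simp, by simp [h]⟩
    · refine ⟨‖l (u k)‖ / l (u k), ?_, by field_simp⟩
      rw [norm_div, Complex.norm_real, norm_norm]
      exact div_self_le_one _
  choose c hc1 hc2 using hc
  have h1 : l (∑ k ∈ s, c k • u k) = ((∑ k ∈ s, ‖l (u k)‖ : ℝ) : ℂ) := by
    rw [map_sum]
    push_cast
    exact Finset.sum_congr rfl fun k _ => by rw [map_smul, smul_eq_mul, hc2]
  calc ∑ k ∈ s, ‖l (u k)‖ = ‖l (∑ k ∈ s, c k • u k)‖ := by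
        rw [h1, Complex.norm_real, Real.norm_of_nonneg (Finset.sum_nonneg fun _ _ => norm_nonneg _)]
    _ ≤ ‖l‖ * ‖∑ k ∈ s, c k • u k‖ := l.le_opNorm _
    _ ≤ ‖l‖ * C := mul_le_mul_of_nonneg_left (hu s c hc1) (norm_nonneg _)

/-- Otherwise let `y k` norm `T (u k)`. Rosenthal's lemma makes the matrix of the values `y j (T (u
k))` almost diagonal along `σ`. Up to the factor `(C + 1)⁻¹`, the functionals are then at least
`3ε/4` on partial sums containing their index and at most `ε/4` on the others. This contradicts the
interchange of iterated limits that weak compactness allows. -/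
theorem IsWeaklyUnconditionallyBounded.not_forall_le_norm {u : ℕ → E} {C : ℝ}
    (hu : IsWeaklyUnconditionallyBounded u C) {T : E →L[ℂ] F} (hT : IsWeaklyCompactOperator T)
    {ε : ℝ} (hε : 0 < ε) : ¬ ∀ k, ε ≤ ‖T (u k)‖ := by
  intro hbig
  have hC : 0 ≤ C := by simpa using hu ∅ 0 (by simp)
  choose y hy1 hy2 using fun k => exists_dual_vector'' ℂ (T (u k))
  obtain ⟨m, hm⟩ := exists_nat_ge (‖T‖ * C / (ε / 4))
  rw [div_le_iff₀ (by positivity)] at hm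
  obtain ⟨σ, hσ, hoff⟩ := exists_injective_sum_erase_le (ε := ε / 4) (by positivity) m
    (fun j k => ‖y j (T (u k))‖) (fun _ _ => norm_nonneg _) (fun j s => by
      refine le_trans ?_ hm
      refine (hu.sum_norm_apply_le (transpose T (y j)) s).trans ?_
      refine mul_le_mul_of_nonneg_right ?_ hC
      refine ContinuousLinearMap.opNorm_le_bound _ (norm_nonneg _) fun x => ?_
      rw [transpose_apply]
      refine ((y j).le_opNorm _).trans ?_
      refine (mul_le_mul_of_nonneg_right (hy1 j) (norm_nonneg _)).trans ?_
      rw [one_mul]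
      exact T.le_opNorm x)
  -- normalised partial sums
  let w : ℕ → E := fun N => ((C + 1)⁻¹ : ℂ) • ∑ k ∈ Finset.range N, u (σ k)
  have hw : ∀ N, w N ∈ closedBall (0 : E) 1 := fun N => by
    have h1 := hu ((Finset.range N).image σ) 1 (by simp)
    rw [Finset.sum_image fun x _ y _ h => hσ h] at h1
    simp only [Pi.one_apply, one_smul] at h1
    have h2 : ‖((C + 1)⁻¹ : ℂ)‖ = (C + 1)⁻¹ := by
      rw [← Complex.ofReal_one, ← Complex.ofReal_add, ← Complex.ofReal_inv, Complex.norm_real,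
        Real.norm_of_nonneg (by positivity)]
    rw [mem_closedBall_zero_iff, norm_smul, h2, inv_mul_le_iff₀ (by positivity)]
    linarith
  have hval : ∀ j N, (y (σ j) (T (w N))).re =
      (C + 1)⁻¹ * ∑ k ∈ Finset.range N, (y (σ j) (T (u (σ k)))).re := fun j N => by
    simp only [w, map_smul, map_sum, smul_eq_mul]
    rw [← Complex.ofReal_one, ← Complex.ofReal_add, ← Complex.ofReal_inv, Complex.re_ofReal_mul,
      Complex.re_sum]
  have hoff' : ∀ j (s : Finset ℕ), |∑ k ∈ s.erase j, (y (σ j) (T (u (σ k)))).re| ≤ ε / 4 :=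
    fun j s => (Finset.abs_sum_le_sum_abs _ _).trans
      ((Finset.sum_le_sum fun k _ => Complex.abs_re_le_norm _).trans (hoff j s))
  have hlow : ∀ j N, j < N → (C + 1)⁻¹ * (3 * ε / 4) ≤ (y (σ j) (T (w N))).re := fun j N hjN => by
    rw [hval]
    refine mul_le_mul_of_nonneg_left ?_ (by positivity)
    rw [← Finset.add_sum_erase _ _ (Finset.mem_range.mpr hjN), hy2]
    have h1 := abs_le.mp (hoff' j (Finset.range N))
    have h2 := hbig (σ j)
    simp only [Complex.coe_algebraMap, Complex.ofReal_re]
    linarith [h1.1]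
  have hupp : ∀ j N, N ≤ j → (y (σ j) (T (w N))).re ≤ (C + 1)⁻¹ * (ε / 4) := fun j N hjN => by
    rw [hval]
    refine mul_le_mul_of_nonneg_left ?_ (by positivity)
    have h1 := abs_le.mp (hoff' j (Finset.range N))
    rw [Finset.erase_eq_of_notMem (by simpa using hjN)] at h1
    exact h1.2
  -- a weak cluster point of the `T (w N)` and a weak-star cluster point of the functionals
  obtain ⟨h, -, hh⟩ := hT.exists_mapClusterPt (f := atTop)
    (u := fun N => toWeakSpace ℂ F (T (w N))) (by
      rw [le_principal_iff]
      exact Filter.mem_map.mpr (Eventually.of_forall fun N =>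
        subset_closure ⟨_, ⟨_, hw N, rfl⟩, rfl⟩))
  obtain ⟨l, -, hl⟩ := (WeakDual.isCompact_closedBall (𝕜 := ℂ) (0 : StrongDual ℂ F)
    1).exists_mapClusterPt (f := atTop) (u := fun j => StrongDual.toWeakDual (y (σ j))) (by
      rw [le_principal_iff]
      exact Filter.mem_map.mpr (Eventually.of_forall fun j => by simpa using hy1 (σ j)))
  have hev : ∀ l : StrongDual ℂ F, Continuous fun x : WeakSpace ℂ F =>
      (l ((toWeakSpace ℂ F).symm x)).re := fun l =>
    Complex.continuous_re.comp (WeakBilin.eval_continuous _ l)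
  have hlow' : ∀ j, (C + 1)⁻¹ * (3 * ε / 4) ≤ (y (σ j) ((toWeakSpace ℂ F).symm h)).re := fun j =>
    (isClosed_le continuous_const (hev (y (σ j)))).mem_of_mapClusterPt hh
      ((eventually_gt_atTop j).mono fun N hN => hlow j N hN)
  have hev' : ∀ x : F, Continuous fun l : WeakDual ℂ F => (l x).re := fun x =>
    Complex.continuous_re.comp (WeakDual.eval_continuous x)
  have h1 : (C + 1)⁻¹ * (3 * ε / 4) ≤ (l ((toWeakSpace ℂ F).symm h)).re :=
    (isClosed_le continuous_const (hev' _)).mem_of_mapClusterPt hl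
      (Eventually.of_forall hlow')
  have hupp' : ∀ N, (l (T (w N))).re ≤ (C + 1)⁻¹ * (ε / 4) := fun N =>
    (isClosed_le (hev' _) continuous_const).mem_of_mapClusterPt hl
      ((eventually_ge_atTop N).mono fun j hj => hupp j N hj)
  have h2 : (l ((toWeakSpace ℂ F).symm h)).re ≤ (C + 1)⁻¹ * (ε / 4) :=
    (isClosed_le (hev (WeakDual.toStrongDual l)) continuous_const).mem_of_mapClusterPt hh
      (Eventually.of_forall hupp')
  have h3 := le_of_mul_le_mul_left (h1.trans h2) (inv_pos.mpr (by linarith : 0 < C + 1))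
  linarith

end Abstract

end VolterraComp

/-! ### Weighted spaces, dilations and Taylor coefficients -/

noncomputable section

set_option maxSynthPendingDepth 3

namespace VolterraComp

theorem mem_disc {z : ℂ} : z ∈ disc ↔ ‖z‖ < 1 := mem_ball_zero_iff

theorem ofReal_mem_disc {r : ℝ} (h0 : 0 ≤ r) (h1 : r < 1) : (r : ℂ) ∈ disc := by
  rwa [mem_disc, Complex.norm_real, Real.norm_of_nonneg h0]

theorem NormalWeight.le_of_norm_le (ν : NormalWeight) {z w : ℂ} (hz : z ∈ disc)
    (h : ‖w‖ ≤ ‖z‖) : ν z ≤ ν w := by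
  have hz' := mem_disc.mp hz
  rw [ν.radial z hz, ν.radial w (mem_disc.mpr (h.trans_lt hz'))]
  exact ν.nonincreasing _ _ (norm_nonneg _) h hz'

theorem NormalWeight.pos_ofReal (ν : NormalWeight) {r : ℝ} (h0 : 0 ≤ r) (h1 : r < 1) :
    0 < ν r := ν.pos _ (ofReal_mem_disc h0 h1)

theorem NormalWeight.le_zero (ν : NormalWeight) {z : ℂ} (hz : z ∈ disc) : ν z ≤ ν 0 :=
  ν.le_of_norm_le hz (by simp)

theorem eventually_boundary_iff {P : ℂ → Prop} :
    (∀ᶠ z in comap (fun z : ℂ => ‖z‖) (𝓝[<] 1), P z) ↔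
      ∃ R : ℝ, 0 ≤ R ∧ R < 1 ∧ ∀ z ∈ disc, R < ‖z‖ → P z := by
  rw [eventually_comap]
  constructor
  · intro h
    obtain ⟨R, hR, hR'⟩ := (mem_nhdsLT_iff_exists_Ioo_subset' (show (0 : ℝ) < 1 by norm_num)).mp h
    refine ⟨max R 0, le_max_right _ _, max_lt hR (by norm_num), fun z hz hRz => ?_⟩
    exact hR' ⟨(le_max_left _ _).trans_lt hRz, mem_disc.mp hz⟩ z rfl
  · rintro ⟨R, -, hR1, h⟩
    filter_upwards [Ioo_mem_nhdsLT hR1] with r hr z hz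
    exact h z (by rw [mem_disc, hz]; exact hr.2) (by rw [hz]; exact hr.1)

theorem vanishesAtBoundary_iff {w : ℂ → ℝ} (hw : ∀ z ∈ disc, 0 ≤ w z) {f : ℂ → ℂ} :
    VanishesAtBoundary w f ↔ ∀ ε > 0, ∃ R : ℝ, 0 ≤ R ∧ R < 1 ∧
      ∀ z ∈ disc, R < ‖z‖ → w z * ‖f z‖ ≤ ε := by
  have hnn : ∀ z ∈ disc, 0 ≤ w z * ‖f z‖ := fun z hz => mul_nonneg (hw z hz) (norm_nonneg _)
  rw [VanishesAtBoundary, Metric.tendsto_nhds]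
  constructor
  · intro h ε hε
    obtain ⟨R, h0, h1, hR⟩ := eventually_boundary_iff.mp (h ε hε)
    refine ⟨R, h0, h1, fun z hz hz' => ?_⟩
    have := hR z hz hz'
    rw [Real.dist_0_eq_abs] at this
    exact (le_abs_self _).trans this.le
  · intro h ε hε
    obtain ⟨R, h0, h1, hR⟩ := h (ε / 2) (by positivity)
    refine eventually_boundary_iff.mpr ⟨R, h0, h1, fun z hz hz' => ?_⟩
    rw [Real.dist_0_eq_abs, abs_of_nonneg (hnn z hz)]
    linarith [hR z hz hz']

/-- Comparing `r` with `0` in the almost decreasing condition gives $\nu(r)\le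
C\nu(0)(1-r^2)^\gamma$. Bounded analytic functions therefore lie in $H^0_\nu$. -/
theorem NormalWeight.vanishesAtBoundary_one (ν : NormalWeight) :
    VanishesAtBoundary ν (fun _ => 1) := by
  obtain ⟨γ, hγ, C, hC, h⟩ := ν.normal_II
  have hlim : Tendsto (fun z : ℂ => C * ν 0 * (1 - ‖z‖ ^ 2) ^ γ)
      (comap (fun z : ℂ => ‖z‖) (𝓝[<] 1)) (𝓝 0) := by
    have h1 : Tendsto (fun r : ℝ => C * ν 0 * (1 - r ^ 2) ^ γ) (𝓝[<] 1) (𝓝 0) := by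
      have : Continuous fun r : ℝ => C * ν 0 * (1 - r ^ 2) ^ γ :=
        continuous_const.mul ((continuous_const.sub (continuous_pow 2)).rpow_const
          fun _ => Or.inr hγ.le)
      have h2 := (this.tendsto 1).mono_left (nhdsWithin_le_nhds (s := Iio 1))
      simpa [Real.zero_rpow hγ.ne'] using h2
    exact h1.comp tendsto_comap
  refine squeeze_zero' ?_ ?_ hlim
  · refine eventually_boundary_iff.mpr ⟨0, le_rfl, by norm_num, fun z hz _ => ?_⟩
    simpa using (ν.pos z hz).le
  · refine eventually_boundary_iff.mpr ⟨0, le_rfl, by norm_num, fun z hz _ => ?_⟩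
    have hz' := mem_disc.mp hz
    have h1 := h 0 ‖z‖ le_rfl (norm_nonneg _) hz'
    have hp : 0 < 1 - ‖z‖ ^ 2 := by nlinarith [norm_nonneg z]
    rw [div_le_iff₀ (Real.rpow_pos_of_pos hp _), ← ν.radial z hz] at h1
    simpa using h1

theorem vanishesAtBoundary_of_bounded (ν : NormalWeight) {f : ℂ → ℂ} {B : ℝ}
    (hf : ∀ z ∈ disc, ‖f z‖ ≤ B) : VanishesAtBoundary ν f := by
  have h := (ν.vanishesAtBoundary_one).const_mul B
  simp only [mul_zero, norm_one, mul_one] at h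
  refine squeeze_zero' ?_ ?_ h
  · refine eventually_boundary_iff.mpr ⟨0, le_rfl, by norm_num, fun z hz _ => ?_⟩
    exact mul_nonneg (ν.pos z hz).le (norm_nonneg _)
  · refine eventually_boundary_iff.mpr ⟨0, le_rfl, by norm_num, fun z hz _ => ?_⟩
    rw [mul_comm]
    exact mul_le_mul_of_nonneg_right (hf z hz) (ν.pos z hz).le

theorem VanishesAtBoundary.congr {w : ℂ → ℝ} {f h : ℂ → ℂ} (hf : VanishesAtBoundary w f)
    (hfh : EqOn f h disc) : VanishesAtBoundary w h := by
  refine Tendsto.congr' ?_ hf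
  exact eventually_boundary_iff.mpr ⟨0, le_rfl, by norm_num, fun z hz _ =>
    congrArg (fun x => w z * ‖x‖) (hfh hz)⟩

variable {ν : NormalWeight}

theorem Hinf.sub_apply (f g : Hinf ν) (z : ℂ) : (f - g) z = f z - g z := by
  rw [sub_eq_add_neg, Hinf.add_apply, Hinf.neg_apply, ← sub_eq_add_neg]

theorem Hinf.sum_apply {ι : Type*} (s : Finset ι) (f : ι → Hinf ν) (z : ℂ) :
    (∑ i ∈ s, f i) z = ∑ i ∈ s, f i z := by
  classical
  induction s using Finset.induction_on with
  | empty => simp [Hinf.zero_apply]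
  | insert i s hi ih => rw [Finset.sum_insert hi, Finset.sum_insert hi, Hinf.add_apply, ih]

theorem Hinf.differentiableOn (f : Hinf ν) : DifferentiableOn ℂ f disc := f.2.1.1

theorem Hinf.norm_apply_le (f : Hinf ν) {z : ℂ} {R : ℝ} (hR : R < 1) (hz : ‖z‖ ≤ R) :
    ‖f z‖ ≤ ‖f‖ / ν R := by
  have h0 : 0 ≤ R := (norm_nonneg z).trans hz
  rw [le_div_iff₀ (ν.pos_ofReal h0 hR), mul_comm]
  refine le_trans ?_ (f.le_norm (mem_disc.mpr (hz.trans_lt hR)))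
  refine mul_le_mul_of_nonneg_right (ν.le_of_norm_le (ofReal_mem_disc h0 hR) ?_) (norm_nonneg _)
  rwa [Complex.norm_real, Real.norm_of_nonneg h0]

/-- An element of `H^∞_ν` from an analytic function with a weighted bound. -/
def Hinf.ofBound (F : ℂ → ℂ) (hF : DifferentiableOn ℂ F disc) (C : ℝ)
    (hC : ∀ z ∈ disc, ν z * ‖F z‖ ≤ C) : Hinf ν :=
  ⟨disc.indicator F, ⟨hF.congr fun z hz => indicator_of_mem hz F, C, by
    rintro _ ⟨z, rfl⟩
    simpa only [indicator_of_mem z.2] using hC z z.2⟩, fun z hz => indicator_of_notMem hz F⟩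

theorem Hinf.ofBound_apply (F : ℂ → ℂ) (hF : DifferentiableOn ℂ F disc) (C : ℝ)
    (hC : ∀ z ∈ disc, ν z * ‖F z‖ ≤ C) {z : ℂ} (hz : z ∈ disc) :
    Hinf.ofBound F hF C hC z = F z := indicator_of_mem hz F

theorem dilate_mem {r : ℝ} (hr : r ∈ Ico (0 : ℝ) 1) {z : ℂ} (hz : z ∈ disc) :
    (r : ℂ) * z ∈ disc ∧ ‖(r : ℂ) * z‖ ≤ r ∧ ‖(r : ℂ) * z‖ ≤ ‖z‖ := by
  have hz' := mem_disc.mp hz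
  have h : ‖(r : ℂ) * z‖ = r * ‖z‖ := by
    rw [norm_mul, Complex.norm_real, Real.norm_of_nonneg hr.1]
  have h2 : r * ‖z‖ ≤ r := mul_le_of_le_one_right hr.1 hz'.le
  have h3 : r * ‖z‖ ≤ ‖z‖ := mul_le_of_le_one_left (norm_nonneg _) hr.2.le
  rw [mem_disc, h]
  exact ⟨h3.trans_lt hz', h2, h3⟩

theorem differentiableOn_dilate {f : ℂ → ℂ} (hf : DifferentiableOn ℂ f disc) {r : ℝ}
    (hr : r ∈ Ico (0 : ℝ) 1) : DifferentiableOn ℂ (fun z => f (r * z)) disc :=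
  hf.comp ((differentiableOn_const (c := (r : ℂ))).mul differentiableOn_id)
    fun _ hz => (dilate_mem hr hz).1

theorem Hinf.dilate_le (f : Hinf ν) {r : ℝ} (hr : r ∈ Ico (0 : ℝ) 1) {z : ℂ} (hz : z ∈ disc) :
    ν z * ‖f (r * z)‖ ≤ ‖f‖ :=
  (mul_le_mul_of_nonneg_right (ν.le_of_norm_le hz (dilate_mem hr hz).2.2) (norm_nonneg _)).trans
    (f.le_norm (dilate_mem hr hz).1)

theorem H0.norm_le {f : H0 ν} {C : ℝ} (h : ∀ z ∈ disc, ν z * ‖(f : Hinf ν) z‖ ≤ C) : ‖f‖ ≤ C :=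
  Hinf.norm_le h

theorem H0.norm_def (f : H0 ν) : ‖f‖ = ‖(f : Hinf ν)‖ := rfl

/-- The dilated function `f(r ·)` as an element of `H^∞_ν`. -/
def Hinf.dilate (r : Ico (0 : ℝ) 1) (f : Hinf ν) : Hinf ν :=
  Hinf.ofBound (fun z => f ((r : ℝ) * z))
    (differentiableOn_dilate f.differentiableOn r.2) ‖f‖ (fun _ hz => f.dilate_le r.2 hz)

theorem Hinf.dilate_apply (r : Ico (0 : ℝ) 1) (f : Hinf ν) {z : ℂ} (hz : z ∈ disc) :
    f.dilate r z = f ((r : ℝ) * z) :=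
  Hinf.ofBound_apply (fun z => f ((r : ℝ) * z)) _ _ _ hz

theorem Hinf.dilate_mem_H0 (r : Ico (0 : ℝ) 1) (f : Hinf ν) : f.dilate r ∈ H0 ν :=
  vanishesAtBoundary_of_bounded ν (B := ‖f‖ / ν (r : ℝ)) fun z hz => by
    rw [f.dilate_apply r hz]
    exact f.norm_apply_le r.2.2 (dilate_mem r.2 hz).2.1

/-- The dilation `f ↦ f(r ·)`, which maps `H^∞_ν` into `H^0_ν`. -/
def dilation (ν : NormalWeight) (r : Ico (0 : ℝ) 1) : Hinf ν →L[ℂ] H0 ν :=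
  LinearMap.mkContinuous
    { toFun := fun f => ⟨f.dilate r, f.dilate_mem_H0 r⟩
      map_add' := fun f g => Subtype.ext (Hinf.ext fun z hz => by
        rw [Submodule.coe_add, Hinf.add_apply, Hinf.dilate_apply r _ hz, Hinf.dilate_apply r _ hz,
          Hinf.dilate_apply r _ hz, Hinf.add_apply])
      map_smul' := fun c f => Subtype.ext (Hinf.ext fun z hz => by
        rw [Submodule.coe_smul, Hinf.smul_apply, Hinf.dilate_apply r _ hz,
          Hinf.dilate_apply r _ hz, Hinf.smul_apply, RingHom.id_apply]) }
    1 (fun f => by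
      rw [one_mul]
      refine H0.norm_le fun z hz => ?_
      have h := f.dilate_le r.2 hz
      rw [← f.dilate_apply r hz] at h
      exact h)

theorem dilation_apply (r : Ico (0 : ℝ) 1) (f : Hinf ν) {z : ℂ} (hz : z ∈ disc) :
    (dilation ν r f : Hinf ν) z = f ((r : ℝ) * z) :=
  f.dilate_apply r hz

theorem norm_dilation_le (r : Ico (0 : ℝ) 1) (f : Hinf ν) : ‖dilation ν r f‖ ≤ ‖f‖ := by
  refine H0.norm_le fun z hz => ?_
  rw [dilation_apply r f hz]
  exact f.dilate_le r.2 hz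

theorem Hinf.contDiffAt_zero (f : Hinf ν) (n : ℕ) : ContDiffAt ℂ n f 0 :=
  (f.differentiableOn.analyticAt (isOpen_ball.mem_nhds (by simp))).contDiffAt

/-- The `k`-th Taylor coefficient at the origin. -/
def Hinf.coeff (k : ℕ) (f : Hinf ν) : ℂ := ((k.factorial : ℂ))⁻¹ * iteratedDeriv k f 0

theorem Hinf.norm_coeff_le (k : ℕ) (f : Hinf ν) {ρ : ℝ} (h0 : 0 < ρ) (h1 : ρ < 1) :
    ‖f.coeff k‖ ≤ ‖f‖ / ν ρ / ρ ^ k := by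
  have hd : DiffContOnCl ℂ f (ball 0 ρ) :=
    (f.differentiableOn.mono (closedBall_subset_ball h1)).diffContOnCl_ball subset_rfl
  have h := Complex.norm_iteratedDeriv_le_of_forall_mem_sphere_norm_le k h0 hd
    (C := ‖f‖ / ν ρ) fun z hz => f.norm_apply_le h1 (by simpa using hz.le)
  rw [Hinf.coeff, norm_mul, norm_inv, Complex.norm_natCast,
    inv_mul_le_iff₀ (by exact_mod_cast k.factorial_pos), ← mul_div_assoc]
  exact h

theorem Hinf.hasSum_coeff (f : Hinf ν) {z : ℂ} (hz : z ∈ disc) :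
    HasSum (fun k => z ^ k * f.coeff k) (f z) := by
  have h := Complex.hasSum_taylorSeries_on_ball f.differentiableOn hz
  have heq : (fun k => z ^ k * f.coeff k) =
      fun n : ℕ => ((n.factorial : ℂ))⁻¹ • (z - 0) ^ n • iteratedDeriv n f 0 := funext fun k => by
    simp only [sub_zero, smul_eq_mul, Hinf.coeff]
    ring
  rw [heq]
  exact h

/-- The `k`-th Taylor coefficient as a bounded functional on `H^0_ν`. -/
def coeffFunctional (ν : NormalWeight) (k : ℕ) : StrongDual ℂ (H0 ν) :=
  LinearMap.mkContinuous
    { toFun := fun f => (f : Hinf ν).coeff k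
      map_add' := fun f g => by
        have h := iteratedDeriv_add ((f : Hinf ν).contDiffAt_zero k) ((g : Hinf ν).contDiffAt_zero k)
        rw [Hinf.coeff, Hinf.coeff, Hinf.coeff, ← mul_add, ← h]
        rfl
      map_smul' := fun c f => by
        have h := iteratedDeriv_const_smul ((f : Hinf ν).contDiffAt_zero k) c
        rw [Hinf.coeff, Hinf.coeff, RingHom.id_apply, smul_eq_mul, mul_left_comm,
          ← smul_eq_mul c, ← h]
        rfl }
    ((ν ((1 / 2 : ℝ) : ℂ))⁻¹ * ((1 / 2 : ℝ) ^ k)⁻¹)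
    (fun f => by
      refine ((f : Hinf ν).norm_coeff_le k (ρ := 1 / 2) (by norm_num) (by norm_num)).trans
        (le_of_eq ?_)
      rw [div_eq_mul_inv, div_eq_mul_inv, mul_assoc, mul_comm]
      rfl)

theorem coeffFunctional_apply (k : ℕ) (f : H0 ν) :
    coeffFunctional ν k f = (f : Hinf ν).coeff k := rfl

/-- Cauchy estimates on the circle of radius `ρ` dominate the Taylor tail by a geometric series of
ratio `r / ρ`. The bound depends on `f` only through its norm, so it also controls operators and
functionals. -/
theorem Hinf.norm_sub_taylor_le (f : Hinf ν) {r ρ : ℝ} (hr0 : 0 ≤ r) (hr : r < ρ) (hρ : ρ < 1)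
    {w : ℂ} (hw : ‖w‖ ≤ r) (N : ℕ) :
    ‖f w - ∑ k ∈ Finset.range N, w ^ k * f.coeff k‖ ≤
      (ν ρ)⁻¹ * ((r / ρ) ^ N * (1 - r / ρ)⁻¹) * ‖f‖ := by
  have hρ0 : 0 < ρ := hr0.trans_lt hr
  have hs := (hasSum_nat_add_iff' N).mpr
    (f.hasSum_coeff (mem_disc.mpr (hw.trans_lt (hr.trans hρ))))
  have hq0 : 0 ≤ r / ρ := by positivity
  have hq1 : r / ρ < 1 := (div_lt_one hρ0).mpr hr
  have hg := (hasSum_geometric_of_lt_one hq0 hq1).mul_left ((ν ρ)⁻¹ * ‖f‖ * (r / ρ) ^ N)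
  refine (hs.norm_le_of_bounded hg fun k => ?_).trans (le_of_eq (by ring))
  have h1 := f.norm_coeff_le (k + N) hρ0 hρ
  rw [norm_mul, norm_pow]
  calc ‖w‖ ^ (k + N) * ‖f.coeff (k + N)‖ ≤ r ^ (k + N) * (‖f‖ / ν ρ / ρ ^ (k + N)) := by
        gcongr
    _ = (ν ρ)⁻¹ * ‖f‖ * (r / ρ) ^ N * (r / ρ) ^ k := by
        rw [div_pow, div_pow, pow_add, pow_add]
        have := (ν.pos_ofReal hρ0.le hρ).ne'
        field_simp

theorem norm_pow_le (ν : NormalWeight) (k : ℕ) (z : ℂ) (hz : z ∈ disc) :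
    ν z * ‖z ^ k‖ ≤ ν 0 := by
  have h1 : ‖z ^ k‖ ≤ 1 := by
    rw [norm_pow]
    exact pow_le_one₀ (norm_nonneg _) (mem_disc.mp hz).le
  exact (mul_le_of_le_one_right (ν.pos z hz).le h1).trans (ν.le_zero hz)

/-- The monomial `z ^ k` as an element of `H^0_ν`. -/
def monomial (ν : NormalWeight) (k : ℕ) : H0 ν :=
  ⟨Hinf.ofBound (fun z => z ^ k) (differentiableOn_pow k) (ν 0) (norm_pow_le ν k),
    (vanishesAtBoundary_of_bounded ν (f := fun z => z ^ k) (B := 1) fun z hz => by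
      rw [norm_pow]
      exact pow_le_one₀ (norm_nonneg _) (mem_disc.mp hz).le).congr
      fun z hz => (Hinf.ofBound_apply _ _ _ _ hz).symm⟩

theorem monomial_apply (k : ℕ) {z : ℂ} (hz : z ∈ disc) : (monomial ν k : Hinf ν) z = z ^ k :=
  Hinf.ofBound_apply (fun z => z ^ k) (differentiableOn_pow k) (ν 0) (norm_pow_le ν k) hz

/-- The partial sums of the Taylor series of `f(r ·)`. -/
def dilationTaylor (ν : NormalWeight) (r : ℝ) (N : ℕ) : H0 ν →L[ℂ] H0 ν :=
  ∑ k ∈ Finset.range N, ((r : ℂ) ^ k) • (coeffFunctional ν k).smulRight (monomial ν k)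

theorem dilationTaylor_apply (r : ℝ) (N : ℕ) (f : H0 ν) :
    dilationTaylor ν r N f =
      ∑ k ∈ Finset.range N, ((r : ℂ) ^ k * (f : Hinf ν).coeff k) • monomial ν k := by
  simp only [dilationTaylor, sum_apply, smul_apply,
    ContinuousLinearMap.smulRight_apply, coeffFunctional_apply, smul_smul]

/-- The dilation as an operator on `H^0_ν`. -/
def dilation₀ (ν : NormalWeight) (r : Ico (0 : ℝ) 1) : H0 ν →L[ℂ] H0 ν :=
  (dilation ν r).comp (H0 ν).subtypeL

theorem dilation₀_apply (r : Ico (0 : ℝ) 1) (f : H0 ν) :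
    dilation₀ ν r f = dilation ν r f := rfl

theorem tendsto_geometric_bound {r ρ : ℝ} (hr0 : 0 ≤ r) (hr : r < ρ) (A B : ℝ) :
    Tendsto (fun N : ℕ => A * ((r / ρ) ^ N * B)) atTop (𝓝 0) := by
  have hρ0 : 0 < ρ := hr0.trans_lt hr
  have h := tendsto_pow_atTop_nhds_zero_of_lt_one (r := r / ρ) (by positivity)
    ((div_lt_one hρ0).mpr hr)
  simpa using (h.mul_const B).const_mul A

theorem tendsto_dilationTaylor (r : Ico (0 : ℝ) 1) :
    Tendsto (dilationTaylor ν r) atTop (𝓝 (dilation₀ ν r)) := by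
  obtain ⟨ρ, hr, hρ⟩ := exists_between r.2.2
  have hρ0 : 0 < ρ := r.2.1.trans_lt hr
  refine (tendsto_iff_norm_sub_tendsto_zero (E := H0 ν →L[ℂ] H0 ν)).mpr ?_
  refine squeeze_zero (fun _ => ContinuousLinearMap.opNorm_nonneg _) (fun N => ?_)
    (tendsto_geometric_bound r.2.1 hr (ν 0 * (ν ρ)⁻¹) (1 - r / ρ)⁻¹)
  have hq1 : 0 < 1 - (r : ℝ) / ρ := sub_pos.mpr ((div_lt_one hρ0).mpr hr)
  have hν := ν.pos_ofReal hρ0.le hρ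
  have hν0 := ν.pos 0 (by simp)
  have hr0 := r.2.1
  refine ContinuousLinearMap.opNorm_le_bound _ (by positivity) fun f => ?_
  refine H0.norm_le fun z hz => ?_
  have h := (f : Hinf ν).norm_sub_taylor_le r.2.1 hr hρ (dilate_mem r.2 hz).2.1 N
  have hz0 := ν.le_zero hz
  have heq : ((dilationTaylor ν r N - dilation₀ ν r) f : H0 ν).1 z =
      -((f : Hinf ν) (r * z) -
        ∑ k ∈ Finset.range N, ((r : ℝ) * z : ℂ) ^ k * (f : Hinf ν).coeff k) := by
    rw [sub_apply, dilationTaylor_apply, dilation₀_apply,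
      Submodule.coe_sub, Hinf.sub_apply, dilation_apply r _ hz, Submodule.coe_sum, Hinf.sum_apply,
      neg_sub]
    congr 1
    refine Finset.sum_congr rfl fun k _ => ?_
    rw [Submodule.coe_smul, Hinf.smul_apply, monomial_apply k hz]
    ring
  rw [heq, norm_neg]
  calc _ ≤ ν 0 * ((ν ρ)⁻¹ * ((r / ρ) ^ N * (1 - r / ρ)⁻¹) * ‖(f : Hinf ν)‖) :=
        mul_le_mul hz0 h (norm_nonneg _) hν0.le
    _ = _ := by rw [Submodule.coe_norm]; ring

/-- The dilation is an operator-norm limit of finite rank Taylor truncations, and compact operators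
into a complete space are closed under norm limits. -/
theorem isCompactOperator_dilation₀_comp {F : Type*} [NormedAddCommGroup F] [NormedSpace ℂ F]
    [CompleteSpace F] (T : H0 ν →L[ℂ] F) (r : Ico (0 : ℝ) 1) :
    IsCompactOperator (T.comp (dilation₀ ν r)) := by
  refine isCompactOperator_of_tendsto (l := atTop) (F := fun N => T.comp (dilationTaylor ν r N))
    ?_ (Eventually.of_forall fun N => ?_)
  · exact ((ContinuousLinearMap.compL ℂ (H0 ν) (H0 ν) F T).continuous.tendsto _).comp
      (tendsto_dilationTaylor r)
  · refine IsCompactOperator.clm_comp ?_ T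
    refine Submodule.sum_mem (compactOperator (RingHom.id ℂ) (H0 ν) (H0 ν)) fun k _ => ?_
    refine Submodule.smul_mem _ _ ?_
    exact (isCompactOperator_of_locallyCompactSpace_dom (coeffFunctional ν k)).clm_comp
      ((ContinuousLinearMap.id ℂ ℂ).smulRight (monomial ν k))

/-- This is the dual form of the Taylor estimate: $\delta_z$ is a norm convergent power series in
$z$ with the coefficient functionals as coefficients. -/
theorem norm_taylor_sub_pointEval_le (z : disc) {r ρ : ℝ} (hz : ‖(z : ℂ)‖ ≤ r) (hr : r < ρ)
    (hρ : ρ < 1) (N : ℕ) :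
    ‖∑ k ∈ Finset.range N, (z : ℂ) ^ k • coeffFunctional ν k - pointEval ν z‖ ≤
      (ν ρ)⁻¹ * ((r / ρ) ^ N * (1 - r / ρ)⁻¹) := by
  have hr0 : 0 ≤ r := (norm_nonneg _).trans hz
  have hρ0 : 0 < ρ := hr0.trans_lt hr
  have hq1 : 0 < 1 - r / ρ := sub_pos.mpr ((div_lt_one hρ0).mpr hr)
  have hν := ν.pos_ofReal hρ0.le hρ
  refine ContinuousLinearMap.opNorm_le_bound _ (by positivity) fun f => ?_
  have h := (f : Hinf ν).norm_sub_taylor_le hr0 hr hρ hz N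
  rw [← norm_neg] at h
  have heq : (∑ k ∈ Finset.range N, (z : ℂ) ^ k • coeffFunctional ν k - pointEval ν z) f =
      -((f : Hinf ν) z - ∑ k ∈ Finset.range N, (z : ℂ) ^ k * (f : Hinf ν).coeff k) := by
    rw [sub_apply, sum_apply, neg_sub]
    rfl
  rw [heq]
  exact h

end VolterraComp

end

/-! ### Gliding humps: weakly compact operators on $H^0_\nu$ are compact -/

noncomputable section

set_option maxSynthPendingDepth 3

namespace VolterraComp

variable {ν : NormalWeight}

/-- Uniform convergence to zero on the discs `|z| ≤ R`, `R < 1`. -/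
def IsLocallyUniformlyNull (f : ℕ → H0 ν) : Prop :=
  ∀ R < 1, ∀ ε > 0, ∀ᶠ n in atTop, ∀ z : ℂ, ‖z‖ ≤ R → ‖(f n : Hinf ν) z‖ ≤ ε

theorem IsLocallyUniformlyNull.comp {f : ℕ → H0 ν} (hf : IsLocallyUniformlyNull f) {τ : ℕ → ℕ}
    (hτ : StrictMono τ) : IsLocallyUniformlyNull (f ∘ τ) :=
  fun R hR ε hε => hτ.tendsto_atTop.eventually (hf R hR ε hε)

/-- At most one term exceeds its geometric bound. It contributes at most `M`, and the geometric
series contributes at most `2`. -/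
theorem sum_le_add_two_of_forall_or {b : ℕ → ℝ} {M : ℝ} (hM : 0 ≤ M) (hb : ∀ k, b k ≤ M)
    (hor : ∀ i j, i < j → b i ≤ (1 / 2) ^ i ∨ b j ≤ (1 / 2) ^ j) (s : Finset ℕ) :
    ∑ k ∈ s, b k ≤ M + 2 := by
  have hgeo : ∑ k ∈ s, (1 / 2 : ℝ) ^ k ≤ 2 :=
    sum_le_hasSum s (fun k _ => by positivity) hasSum_geometric_two
  by_cases h : ∃ i, (1 / 2) ^ i < b i
  · obtain ⟨i, hi⟩ := h
    have h1 : ∀ k, b k ≤ (if k = i then M else 0) + (1 / 2) ^ k := fun k => by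
      split_ifs with hk
      · exact (hb k).trans (by simp)
      · rw [zero_add]
        rcases lt_or_gt_of_ne hk with hk | hk
        · exact (hor k i hk).resolve_right (not_le.mpr hi)
        · exact (hor i k hk).resolve_left (not_le.mpr hi)
    refine (Finset.sum_le_sum fun k _ => h1 k).trans ?_
    rw [Finset.sum_add_distrib, Finset.sum_ite_eq']
    refine add_le_add ?_ hgeo
    split_ifs
    · exact le_rfl
    · exact hM
  · push Not at h
    linarith [Finset.sum_le_sum fun k (_ : k ∈ s) => h k]

/-- A bounded, locally uniformly null sequence in `H^0_ν` has a subsequence whose humps are almost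
disjoint. -/
theorem IsLocallyUniformlyNull.exists_isWeaklyUnconditionallyBounded {f : ℕ → H0 ν}
    (hf : IsLocallyUniformlyNull f) {M : ℝ} (hM : ∀ n, ‖f n‖ ≤ M) :
    ∃ (τ : ℕ → ℕ) (C : ℝ), IsWeaklyUnconditionallyBounded (f ∘ τ) C := by
  have hν0 := ν.pos 0 (by simp)
  -- A pair consists of a tolerance exponent and an index into `f`. Beyond its radius `R p` an
  -- earlier function is small because it lies in $H^0_\nu$; inside that radius the new one is small
  -- by locally uniform convergence. Hence at each point at most one chosen function exceeds its
  -- tolerance. The exponents increase strictly; the indices need not.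
  obtain ⟨p, -, hp⟩ := exists_seq_of_forall_finset_exists (α := ℕ × ℕ) (fun _ => True)
    (fun p q => p.1 < q.1 ∧ ∀ z ∈ disc, ν z * ‖(f p.2 : Hinf ν) z‖ ≤ (1 / 2) ^ p.1 ∨
      ν z * ‖(f q.2 : Hinf ν) z‖ ≤ (1 / 2) ^ q.1) (fun s _ => by
    let k := s.sup Prod.fst + 1
    have hR : ∀ p : ℕ × ℕ, ∃ R : ℝ, 0 ≤ R ∧ R < 1 ∧
        ∀ z ∈ disc, R < ‖z‖ → ν z * ‖(f p.2 : Hinf ν) z‖ ≤ (1 / 2) ^ p.1 := fun p =>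
      (vanishesAtBoundary_iff fun z hz => (ν.pos z hz).le).mp (f p.2).2 _ (by positivity)
    choose R _ hR1 hR using hR
    have hev : ∀ᶠ n in atTop, ∀ p ∈ s, ∀ z : ℂ, ‖z‖ ≤ R p →
        ‖(f n : Hinf ν) z‖ ≤ (1 / 2) ^ k / ν 0 :=
      (eventually_all_finset s).mpr fun p _ => hf (R p) (hR1 p) _ (by positivity)
    obtain ⟨n, hn⟩ := hev.exists
    refine ⟨(k, n), trivial, fun p hp => ⟨?_, fun z hz => ?_⟩⟩
    · exact Nat.lt_succ_of_le (Finset.le_sup (f := Prod.fst) hp)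
    · by_cases hz' : R p < ‖z‖
      · exact Or.inl (hR p z hz hz')
      · refine Or.inr ?_
        have h1 := hn p hp z (not_lt.mp hz')
        rw [le_div_iff₀ hν0] at h1
        rw [mul_comm]
        exact (mul_le_mul_of_nonneg_left (ν.le_zero hz) (norm_nonneg _)).trans h1)
  have hmono : StrictMono fun k => (p k).1 := fun i j hij => (hp i j hij).1
  have hpow : ∀ k, (1 / 2 : ℝ) ^ (p k).1 ≤ (1 / 2) ^ k := fun k =>
    pow_le_pow_of_le_one (by norm_num) (by norm_num) (hmono.le_apply)
  have hM0 : 0 ≤ M := (Hinf.norm_nonneg' (f 0 : Hinf ν)).trans (hM 0)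
  refine ⟨fun k => (p k).2, M + 2, fun s c hc => H0.norm_le fun z hz => ?_⟩
  have hb := sum_le_add_two_of_forall_or (b := fun k => ν z * ‖(f (p k).2 : Hinf ν) z‖) hM0
    (fun k => ((f (p k).2 : Hinf ν).le_norm hz).trans (hM _))
    (fun i j hij => ((hp i j hij).2 z hz).imp (fun h => h.trans (hpow i))
      fun h => h.trans (hpow j)) s
  refine le_trans ?_ hb
  rw [Submodule.coe_sum, Hinf.sum_apply, ← Finset.mul_sum]
  refine mul_le_mul_of_nonneg_left ((norm_sum_le _ _).trans (Finset.sum_le_sum fun k _ => ?_))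
    (ν.pos z hz).le
  rw [Submodule.coe_smul, Hinf.smul_apply, norm_mul]
  exact mul_le_of_le_one_left (norm_nonneg _) (hc k)

variable {F : Type*} [NormedAddCommGroup F] [NormedSpace ℂ F]

/-- If the norms did not tend to `0`, a subsequence would keep them above some `ε`; its almost
disjoint humps would contradict weak compactness. -/
theorem IsLocallyUniformlyNull.tendsto_apply {f : ℕ → H0 ν}
    (hf : IsLocallyUniformlyNull f) {M : ℝ} (hM : ∀ n, ‖f n‖ ≤ M) {T : H0 ν →L[ℂ] F}
    (hT : IsWeaklyCompactOperator T) : Tendsto (fun n => ‖T (f n)‖) atTop (𝓝 0) := by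
  by_contra hcon
  rw [Metric.tendsto_nhds] at hcon
  push Not at hcon
  obtain ⟨ε, hε, hfreq⟩ := hcon
  obtain ⟨τ, hτ, hτε⟩ := extraction_of_frequently_atTop hfreq
  obtain ⟨κ, C, hκ⟩ := (hf.comp hτ).exists_isWeaklyUnconditionallyBounded (fun n => hM (τ n))
  refine hκ.not_forall_le_norm hT hε fun k => ?_
  simpa using hτε (κ k)

/-- The radii `1 - 1/(n+2)`. -/
def radius (n : ℕ) : Ico (0 : ℝ) 1 :=
  ⟨1 - 1 / ((n : ℝ) + 2), by
    have h : (0 : ℝ) < n + 2 := by positivity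
    constructor
    · rw [sub_nonneg, div_le_one h]
      linarith [n.cast_nonneg (α := ℝ)]
    · linarith [one_div_pos.mpr h]⟩

theorem tendsto_radius : Tendsto (fun n => (radius n : ℝ)) atTop (𝓝 1) := by
  have h : Tendsto (fun n : ℕ => (1 : ℝ) / (((n + 1 : ℕ) : ℝ) + 1)) atTop (𝓝 0) :=
    tendsto_one_div_add_atTop_nhds_zero_nat.comp (tendsto_add_atTop_nat 1)
  have h2 := h.const_sub 1
  rw [sub_zero] at h2
  refine h2.congr fun n => ?_
  simp only [radius]
  push_cast
  ring_nf

/-- Cauchy's estimate on the circle of radius `(1 - R) / 2` about `w`, which stays within radius `(1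
+ R) / 2` of the origin. -/
theorem Hinf.norm_deriv_le (f : Hinf ν) {R : ℝ} (hR : R < 1) {w : ℂ} (hw : ‖w‖ ≤ R) :
    ‖deriv f w‖ ≤ ‖f‖ / ν ((1 + R) / 2 : ℝ) / ((1 - R) / 2) := by
  have hsub : closedBall w ((1 - R) / 2) ⊆ closedBall 0 ((1 + R) / 2) :=
    closedBall_subset_closedBall' (by rw [dist_zero_right]; linarith)
  have hd : DiffContOnCl ℂ f (ball w ((1 - R) / 2)) :=
    (f.differentiableOn.mono (hsub.trans (closedBall_subset_ball
      (by linarith)))).diffContOnCl_ball subset_rfl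
  refine Complex.norm_deriv_le_of_forall_mem_sphere_norm_le (by linarith) hd fun x hx => ?_
  refine f.norm_apply_le (by linarith) ?_
  simpa using hsub (sphere_subset_closedBall hx)

theorem Hinf.norm_sub_dilate_le (f : Hinf ν) {R : ℝ} (hR : R < 1) (r : Ico (0 : ℝ) 1) {z : ℂ}
    (hz : ‖z‖ ≤ R) :
    ‖f z - f ((r : ℝ) * z)‖ ≤ ‖f‖ / ν ((1 + R) / 2 : ℝ) / ((1 - R) / 2) * (1 - r) := by
  have h0 : 0 ≤ R := (norm_nonneg z).trans hz
  have hsub : closedBall (0 : ℂ) R ⊆ disc := closedBall_subset_ball hR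
  have hder : ∀ w ∈ closedBall (0 : ℂ) R,
      ‖deriv f w‖ ≤ ‖f‖ / ν ((1 + R) / 2 : ℝ) / ((1 - R) / 2) := fun w hw =>
    f.norm_deriv_le hR (by simpa using hw)
  have hB : 0 ≤ ‖f‖ / ν ((1 + R) / 2 : ℝ) / ((1 - R) / 2) :=
    (norm_nonneg _).trans (hder 0 (by simpa using h0))
  have hrz := dilate_mem r.2 (mem_disc.mpr (hz.trans_lt hR))
  have h1 := Convex.norm_image_sub_le_of_norm_deriv_le (𝕜 := ℂ)
    (fun w hw => f.differentiableOn.differentiableAt (isOpen_ball.mem_nhds (hsub hw))) hder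
    (convex_closedBall 0 R) (x := ((r : ℝ) : ℂ) * z) (y := z)
    (by simpa using hrz.2.2.trans hz) (by simpa using hz)
  refine h1.trans (mul_le_mul_of_nonneg_left ?_ hB)
  have h2 : z - ((r : ℝ) : ℂ) * z = ((1 - r : ℝ) : ℂ) * z := by push_cast; ring
  have hr : 0 ≤ 1 - (r : ℝ) := by linarith [r.2.2]
  rw [h2, norm_mul, Complex.norm_real, Real.norm_of_nonneg hr]
  exact mul_le_of_le_one_right hr (hz.trans hR.le)

/-- The mean value bound is uniform over bounded sets, so the function may change with the radius,
as it must for almost norming vectors. -/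
theorem isLocallyUniformlyNull_sub_dilation {f : ℕ → H0 ν} {M : ℝ} (hM : ∀ n, ‖f n‖ ≤ M) :
    IsLocallyUniformlyNull fun n => f n - dilation₀ ν (radius n) (f n) := by
  intro R hR ε hε
  wlog h0 : 0 ≤ R generalizing R
  · filter_upwards [this 0 (by norm_num) le_rfl] with n hn z hz
    exact hn z (hz.trans (not_le.mp h0).le)
  have hν := ν.pos_ofReal (r := (1 + R) / 2) (by linarith) (by linarith)
  have hR2 : 0 < (1 - R) / 2 := by linarith
  have hlim : Tendsto (fun n => M / ν ((1 + R) / 2 : ℝ) / ((1 - R) / 2) * (1 - radius n))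
      atTop (𝓝 0) := by
    simpa using (tendsto_radius.const_sub 1).const_mul (M / ν ((1 + R) / 2 : ℝ) / ((1 - R) / 2))
  filter_upwards [hlim.eventually_le_const hε] with n hn z hz
  have heq : ((f n - dilation₀ ν (radius n) (f n) : H0 ν) : Hinf ν) z =
      (f n : Hinf ν) z - (f n : Hinf ν) ((radius n : ℝ) * z) := by
    rw [Submodule.coe_sub, Hinf.sub_apply, dilation₀_apply,
      dilation_apply _ _ (mem_disc.mpr (hz.trans_lt hR))]
  rw [heq]
  refine ((f n : Hinf ν).norm_sub_dilate_le hR (radius n) hz).trans (le_trans ?_ hn)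
  have h1 : 0 ≤ 1 - (radius n : ℝ) := by linarith [(radius n).2.2]
  have h2 : ‖(f n : Hinf ν)‖ ≤ M := hM n
  gcongr

theorem norm_dilation₀_le (r : Ico (0 : ℝ) 1) (f : H0 ν) : ‖dilation₀ ν r f‖ ≤ ‖f‖ := by
  rw [dilation₀_apply, H0.norm_def f]
  exact norm_dilation_le r (f : Hinf ν)

/-- Weakly compact operators on `H^0_ν` are approximated by their compositions with dilations. -/
theorem IsWeaklyCompactOperator.tendsto_comp_dilation {T : H0 ν →L[ℂ] F}
    (hT : IsWeaklyCompactOperator T) :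
    Tendsto (fun n => T.comp (dilation₀ ν (radius n))) atTop (𝓝 T) := by
  -- The norm need not be attained, so the unit vectors are norming only up to a factor `2`.
  have hex : ∀ A : H0 ν →L[ℂ] F, ∃ f, ‖f‖ ≤ 1 ∧ ‖A‖ ≤ 2 * ‖A f‖ := fun A => by
    by_cases hA : ‖A‖ = 0
    · exact ⟨0, by simp, by simp [hA]⟩
    · have hA' : 0 < ‖A‖ := lt_of_le_of_ne A.opNorm_nonneg (Ne.symm hA)
      obtain ⟨f, hf, hf'⟩ := A.exists_lt_apply_of_lt_opNorm (half_lt_self hA')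
      exact ⟨f, hf.le, by linarith⟩
  choose f hf1 hf2 using fun n => hex (T.comp (dilation₀ ν (radius n)) - T)
  refine (tendsto_iff_norm_sub_tendsto_zero (E := H0 ν →L[ℂ] F)).mpr ?_
  have hnull := isLocallyUniformlyNull_sub_dilation hf1
  have hbd : ∀ n, ‖f n - dilation₀ ν (radius n) (f n)‖ ≤ 2 := fun n => by
    have h1 := norm_sub_le (f n) (dilation₀ ν (radius n) (f n))
    have h2 := norm_dilation₀_le (radius n) (f n)
    linarith [hf1 n]
  have hlim := (hnull.tendsto_apply hbd hT).const_mul 2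
  rw [mul_zero] at hlim
  refine squeeze_zero (fun _ => ContinuousLinearMap.opNorm_nonneg _) (fun n => ?_) hlim
  refine (hf2 n).trans (le_of_eq ?_)
  rw [sub_apply, ContinuousLinearMap.comp_apply, ← map_sub, ← neg_sub (f n), map_neg, norm_neg]

theorem IsWeaklyCompactOperator.isCompactOperator [CompleteSpace F] {T : H0 ν →L[ℂ] F}
    (hT : IsWeaklyCompactOperator T) : IsCompactOperator T :=
  isCompactOperator_of_tendsto hT.tendsto_comp_dilation
    (Eventually.of_forall fun n => isCompactOperator_dilation₀_comp T (radius n))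

/-- Makes the approximation by dilations available for functionals, where it yields norm convergence
in the dual. -/
theorem isWeaklyCompactOperator_functional {E : Type*} [NormedAddCommGroup E] [NormedSpace ℂ E]
    (l : StrongDual ℂ E) : IsWeaklyCompactOperator l :=
  isWeaklyCompactOperator_of_isCompactOperator (isCompactOperator_of_locallyCompactSpace_dom l)

end VolterraComp

end

/-! ### The bidual of $H^0_\nu$ -/

noncomputable section

set_option maxSynthPendingDepth 3

namespace VolterraComp

variable {ν : NormalWeight}

theorem norm_pointEval_le (z : disc) : ‖pointEval ν z‖ ≤ (ν z)⁻¹ :=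
  LinearMap.mkContinuous_norm_le _ (inv_nonneg.mpr (ν.pos z z.2).le) _

theorem norm_coeffFunctional_le (k : ℕ) :
    ‖coeffFunctional ν k‖ ≤ (ν ((1 / 2 : ℝ) : ℂ))⁻¹ * ((1 / 2 : ℝ) ^ k)⁻¹ :=
  LinearMap.mkContinuous_norm_le _ (by
    have := ν.pos_ofReal (r := 1 / 2) (by norm_num) (by norm_num)
    positivity) _

/-- The bidual of `H^0_ν`. -/
abbrev Bidual (ν : NormalWeight) : Type := StrongDual ℂ (StrongDual ℂ (H0 ν))

open Classical in
/-- The function `z ↦ ⟨x, δ_z⟩` on the disc, extended by zero. -/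
def bidualFun (x : Bidual ν) (z : ℂ) : ℂ := if h : z ∈ disc then x (pointEval ν ⟨z, h⟩) else 0

theorem bidualFun_apply (x : Bidual ν) (z : disc) : bidualFun x z = x (pointEval ν z) :=
  dif_pos z.2

theorem norm_bidual_taylor_sub_le (x : Bidual ν) (z : disc) {r ρ : ℝ} (hz : ‖(z : ℂ)‖ ≤ r)
    (hr : r < ρ) (hρ : ρ < 1) (N : ℕ) :
    ‖∑ k ∈ Finset.range N, (z : ℂ) ^ k * x (coeffFunctional ν k) - x (pointEval ν z)‖ ≤
      ‖x‖ * (ν ρ)⁻¹ * ((r / ρ) ^ N * (1 - r / ρ)⁻¹) := by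
  have heq : ∑ k ∈ Finset.range N, (z : ℂ) ^ k * x (coeffFunctional ν k) - x (pointEval ν z) =
      x (∑ k ∈ Finset.range N, (z : ℂ) ^ k • coeffFunctional ν k - pointEval ν z) := by
    rw [map_sub, map_sum]
    simp only [map_smul, smul_eq_mul]
  rw [heq, mul_assoc]
  exact (x.le_opNorm _).trans (mul_le_mul_of_nonneg_left
    (norm_taylor_sub_pointEval_le z hz hr hρ N) x.opNorm_nonneg)

/-- Applying `x` to the power series of $\delta_z$ exhibits the function as a locally uniform limit
of polynomials. -/
theorem differentiableOn_bidualFun (x : Bidual ν) : DifferentiableOn ℂ (bidualFun x) disc := by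
  have hlim : TendstoLocallyUniformlyOn
      (fun (N : ℕ) (z : ℂ) => ∑ k ∈ Finset.range N, z ^ k * x (coeffFunctional ν k))
      (bidualFun x) atTop disc := by
    refine Metric.tendstoLocallyUniformlyOn_iff.mpr fun ε hε w hw => ?_
    obtain ⟨r, hwr, hr1⟩ := exists_between (mem_disc.mp hw)
    obtain ⟨ρ, hr, hρ⟩ := exists_between hr1
    have h0 : 0 ≤ r := (norm_nonneg _).trans hwr.le
    refine ⟨ball 0 r ∩ disc, inter_mem (mem_nhdsWithin_of_mem_nhds
      (isOpen_ball.mem_nhds (by simpa using hwr))) self_mem_nhdsWithin, ?_⟩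
    have hbound := tendsto_geometric_bound h0 hr (‖x‖ * (ν ρ)⁻¹) (1 - r / ρ)⁻¹
    filter_upwards [hbound.eventually_lt_const hε] with N hN z hz
    have h := norm_bidual_taylor_sub_le x ⟨z, hz.2⟩ (r := r) (mem_ball_zero_iff.mp hz.1).le hr hρ N
    rw [dist_comm, dist_eq_norm, ← Subtype.coe_mk z hz.2, bidualFun_apply]
    exact h.trans_lt hN
  exact hlim.differentiableOn (Eventually.of_forall fun N =>
    (DifferentiableOn.fun_sum fun k _ => (differentiableOn_pow k).mul_const _)) isOpen_ball

theorem bidualFun_le (x : Bidual ν) (z : ℂ) (hz : z ∈ disc) : ν z * ‖bidualFun x z‖ ≤ ‖x‖ := by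
  have h1 := x.le_of_opNorm_le_of_le le_rfl (norm_pointEval_le (ν := ν) ⟨z, hz⟩)
  rw [← bidualFun_apply, ← div_eq_mul_inv, le_div_iff₀ (ν.pos z hz), mul_comm] at h1
  exact h1

/-- Uniqueness of power series coefficients; the growth bound on `c` upgrades convergence of partial
sums to summability. -/
theorem eq_zero_of_pow_series {c : ℕ → ℂ} {ρ B : ℝ} (hρ : 0 < ρ)
    (hc : ∀ k, ‖c k‖ ≤ B * (ρ ^ k)⁻¹)
    (h0 : ∀ z : ℂ, ‖z‖ < ρ → Tendsto (fun N => ∑ k ∈ Finset.range N, z ^ k * c k) atTop (𝓝 0))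
    (k : ℕ) : c k = 0 := by
  have hs : ∀ z : ℂ, ‖z‖ < ρ → HasSum (fun k => z ^ k * c k) 0 := fun z hz => by
    refine (Summable.hasSum_iff_tendsto_nat ?_).mpr (h0 z hz)
    refine Summable.of_norm_bounded (g := fun k => B * (‖z‖ / ρ) ^ k)
      ((summable_geometric_of_lt_one (by positivity) ((div_lt_one hρ).mpr hz)).mul_left B)
      fun k => ?_
    rw [norm_mul, norm_pow, div_pow]
    refine (mul_le_mul_of_nonneg_left (hc k) (by positivity)).trans (le_of_eq ?_)
    ring
  have hp : HasFPowerSeriesAt (0 : ℂ → ℂ) (FormalMultilinearSeries.ofScalars ℂ c) 0 := by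
    rw [hasFPowerSeriesAt_iff]
    filter_upwards [ball_mem_nhds (0 : ℂ) hρ] with z hz
    simpa [FormalMultilinearSeries.coeff_ofScalars] using hs z (by simpa using hz)
  have h1 := congrArg (fun p : FormalMultilinearSeries ℂ ℂ ℂ => p.coeff k) hp.eq_zero
  simp only [FormalMultilinearSeries.coeff_ofScalars] at h1
  exact h1

theorem bidual_coeffFunctional_eq_zero {x : Bidual ν} (hx : ∀ z, x (pointEval ν z) = 0) (k : ℕ) :
    x (coeffFunctional ν k) = 0 := by
  refine eq_zero_of_pow_series (c := fun k => x (coeffFunctional ν k)) (ρ := 1 / 2)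
    (B := ‖x‖ * (ν ((1 / 2 : ℝ) : ℂ))⁻¹) (by norm_num) (fun k => ?_) (fun z hz => ?_) k
  · rw [mul_assoc]
    exact x.le_of_opNorm_le_of_le le_rfl (norm_coeffFunctional_le k)
  · have hz1 : z ∈ disc := mem_disc.mpr (hz.trans (by norm_num))
    obtain ⟨ρ, hr, hρ⟩ := exists_between (mem_disc.mp hz1)
    refine squeeze_zero_norm (fun N => ?_)
      (tendsto_geometric_bound (norm_nonneg _) hr (‖x‖ * (ν ρ)⁻¹) (1 - ‖z‖ / ρ)⁻¹)
    have h := norm_bidual_taylor_sub_le x ⟨z, hz1⟩ (r := ‖z‖) le_rfl hr hρ N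
    rwa [hx, sub_zero] at h

theorem tendsto_functional_comp_dilation (l : StrongDual ℂ (H0 ν)) :
    Tendsto (fun n => l.comp (dilation₀ ν (radius n))) atTop (𝓝 l) :=
  (isWeaklyCompactOperator_functional l).tendsto_comp_dilation

theorem tendsto_functional_dilation (l : StrongDual ℂ (H0 ν)) (f : H0 ν) :
    Tendsto (fun n => l (dilation ν (radius n) f)) atTop (𝓝 (l f)) :=
  ((ContinuousLinearMap.apply ℂ ℂ f).continuous.tendsto l).comp
    (tendsto_functional_comp_dilation l)

/-- The point evaluations are total in the dual of `H^0_ν`. -/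
theorem bidual_eq_zero {x : Bidual ν} (hx : ∀ z, x (pointEval ν z) = 0) : x = 0 := by
  -- `l` composed with a dilation is a norm limit of combinations of coefficient functionals, all
  -- killed by `x`. Letting the radius tend to `1` in norm then gives `x l = 0`.
  have hr : ∀ (r : Ico (0 : ℝ) 1) (l : StrongDual ℂ (H0 ν)), x (l.comp (dilation₀ ν r)) = 0 :=
    fun r l => by
    have h1 : Tendsto (fun N => x (l.comp (dilationTaylor ν r N))) atTop
        (𝓝 (x (l.comp (dilation₀ ν r)))) :=
      (x.continuous.tendsto _).comp (((ContinuousLinearMap.compL ℂ (H0 ν) (H0 ν) ℂ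
        l).continuous.tendsto _).comp (tendsto_dilationTaylor r))
    refine tendsto_nhds_unique h1 (tendsto_const_nhds.congr fun N => ?_)
    have h2 : l.comp (dilationTaylor ν r N) = ∑ k ∈ Finset.range N,
        (((r : ℝ) : ℂ) ^ k * l (monomial ν k)) • coeffFunctional ν k := by
      refine ContinuousLinearMap.ext fun f => ?_
      rw [ContinuousLinearMap.comp_apply, dilationTaylor_apply, map_sum, sum_apply]
      refine Finset.sum_congr rfl fun k _ => ?_
      rw [map_smul, smul_apply, coeffFunctional_apply, smul_eq_mul, smul_eq_mul]
      ring
    rw [h2, map_sum]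
    exact (Finset.sum_eq_zero fun k _ => by
      rw [map_smul, bidual_coeffFunctional_eq_zero hx, smul_zero]).symm
  refine ContinuousLinearMap.ext fun l => ?_
  refine tendsto_nhds_unique
    ((x.continuous.tendsto l).comp (tendsto_functional_comp_dilation l)) ?_
  exact tendsto_const_nhds.congr fun n => (hr (radius n) l).symm

theorem dilation₀_dilation_comm (r s : Ico (0 : ℝ) 1) (f : Hinf ν) :
    dilation₀ ν r (dilation ν s f) = dilation₀ ν s (dilation ν r f) := by
  refine Subtype.ext (Hinf.ext fun z hz => ?_)
  rw [dilation₀_apply, dilation₀_apply, dilation_apply _ _ hz, dilation_apply _ _ hz,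
    dilation_apply _ _ (dilate_mem r.2 hz).1, dilation_apply _ _ (dilate_mem s.2 hz).1,
    mul_left_comm]

theorem tendsto_dilation_apply (f : Hinf ν) {z : ℂ} (hz : z ∈ disc) :
    Tendsto (fun n => (dilation ν (radius n) f : Hinf ν) z) atTop (𝓝 (f z)) := by
  have hc : ContinuousAt f (1 * z) := by
    rw [one_mul]
    exact (f.differentiableOn.differentiableAt (isOpen_ball.mem_nhds hz)).continuousAt
  have h1 : Tendsto (fun n => ((radius n : ℝ) : ℂ) * z) atTop (𝓝 (1 * z)) :=
    ((Complex.continuous_ofReal.tendsto 1).comp tendsto_radius).mul_const z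
  have h2 := hc.tendsto.comp h1
  rw [one_mul] at h2
  exact h2.congr fun n => (dilation_apply _ f hz).symm

/-- A weak-star cluster point of the dilates of `f`, bounded by `‖f‖`, provides `x`. Norm
convergence of functionals composed with dilations upgrades clustering to convergence of the whole
sequence. -/
theorem exists_bidual (f : Hinf ν) : ∃ x : Bidual ν, ‖x‖ ≤ ‖f‖ ∧
    (∀ z : disc, x (pointEval ν z) = f z) ∧
    ∀ l : StrongDual ℂ (H0 ν), Tendsto (fun n => l (dilation ν (radius n) f)) atTop (𝓝 (x l)) := by
  let u : ℕ → WeakDual ℂ (StrongDual ℂ (H0 ν)) := fun n =>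
    StrongDual.toWeakDual (NormedSpace.inclusionInDoubleDual ℂ (H0 ν) (dilation ν (radius n) f))
  obtain ⟨y, hy, hclus⟩ := (WeakDual.isCompact_closedBall (𝕜 := ℂ) (0 : Bidual ν)
    ‖f‖).exists_mapClusterPt (f := atTop) (u := u) (by
      rw [le_principal_iff]
      refine Filter.mem_map.mpr (Eventually.of_forall fun n => ?_)
      have h := (NormedSpace.double_dual_bound ℂ (H0 ν) (dilation ν (radius n) f)).trans
        (norm_dilation_le _ f)
      exact (mem_closedBall_zero_iff (E := Bidual ν)).mpr h)
  obtain ⟨U, hU, hlim⟩ := mapClusterPt_iff_ultrafilter.mp hclus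
  let x : Bidual ν := WeakDual.toStrongDual y
  have hx : ∀ l : StrongDual ℂ (H0 ν),
      Tendsto (fun n => l (dilation ν (radius n) f)) U (𝓝 (x l)) := fun l =>
    ((WeakDual.eval_continuous l).tendsto y).comp hlim
  -- Dilations commute, so the limit can be taken along the dilates of `dilation ν (radius n) f`,
  -- which is already in $H^0_\nu$.
  have hxr : ∀ n (l : StrongDual ℂ (H0 ν)), x (l.comp (dilation₀ ν (radius n))) =
      l (dilation ν (radius n) f) := fun n l => by
    refine tendsto_nhds_unique (hx (l.comp (dilation₀ ν (radius n)))) ?_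
    refine ((tendsto_functional_dilation l (dilation ν (radius n) f)).mono_left hU).congr
      fun m => ?_
    rw [ContinuousLinearMap.comp_apply, ← dilation₀_dilation_comm, dilation₀_apply]
  refine ⟨x, (mem_closedBall_zero_iff (E := Bidual ν)).mp hy, fun z => ?_, fun l => ?_⟩
  · exact tendsto_nhds_unique (hx (pointEval ν z)) ((tendsto_dilation_apply f z.2).mono_left hU)
  · exact ((x.continuous.tendsto l).comp (tendsto_functional_comp_dilation l)).congr
      fun n => hxr n l

/-- The restriction of a functional on the dual of `H^0_ν` to the point evaluations. -/
def bidualToHinf (ν : NormalWeight) : Bidual ν →ₗ[ℂ] Hinf ν where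
  toFun x := Hinf.ofBound (bidualFun x) (differentiableOn_bidualFun x) ‖x‖ (bidualFun_le x)
  map_add' x y := Hinf.ext fun z hz => by
    rw [Hinf.add_apply, Hinf.ofBound_apply _ _ _ _ hz, Hinf.ofBound_apply _ _ _ _ hz,
      Hinf.ofBound_apply _ _ _ _ hz, ← Subtype.coe_mk z hz, bidualFun_apply, bidualFun_apply,
      bidualFun_apply]
    rfl
  map_smul' c x := Hinf.ext fun z hz => by
    rw [Hinf.smul_apply, Hinf.ofBound_apply _ _ _ _ hz, Hinf.ofBound_apply _ _ _ _ hz,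
      ← Subtype.coe_mk z hz, bidualFun_apply, bidualFun_apply]
    rfl

theorem bidualToHinf_apply (x : Bidual ν) (z : disc) :
    bidualToHinf ν x z = x (pointEval ν z) :=
  (Hinf.ofBound_apply (bidualFun x) (differentiableOn_bidualFun x) ‖x‖ (bidualFun_le x)
    z.2).trans (bidualFun_apply x z)

theorem bidualToHinf_injective : Function.Injective (bidualToHinf ν) := by
  refine (injective_iff_map_eq_zero _).mpr fun x hx => bidual_eq_zero fun z => ?_
  rw [← bidualToHinf_apply, hx, Hinf.zero_apply]

/-- One inequality is the bound $\|\delta_z\|\le\nu(z)^{-1}$. For the other, `exists_bidual`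
supplies a preimage of no larger norm, which is `x` by injectivity. -/
theorem norm_bidualToHinf (x : Bidual ν) : ‖bidualToHinf ν x‖ = ‖x‖ := by
  refine le_antisymm (Hinf.norm_le fun z hz => ?_) ?_
  · have h := bidualFun_le x z hz
    rwa [← Subtype.coe_mk z hz, bidualFun_apply, ← bidualToHinf_apply] at h
  · obtain ⟨y, hy, hyz, -⟩ := exists_bidual (bidualToHinf ν x)
    have : y = x := bidualToHinf_injective (Hinf.ext fun z hz => by
      rw [← Subtype.coe_mk z hz, bidualToHinf_apply y, hyz])
    rwa [this] at hy

theorem bidualToHinf_surjective : Function.Surjective (bidualToHinf ν) := fun f => by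
  obtain ⟨y, -, hyz, -⟩ := exists_bidual f
  exact ⟨y, Hinf.ext fun z hz => by rw [← Subtype.coe_mk z hz, bidualToHinf_apply y, hyz]⟩

/-- The canonical isometric identification of `H^∞_ν` with the bidual of `H^0_ν`. -/
def canonicalBidual (ν : NormalWeight) : Hinf ν ≃ₗᵢ[ℂ] Bidual ν :=
  (LinearIsometryEquiv.ofSurjective ⟨bidualToHinf ν, norm_bidualToHinf⟩
    bidualToHinf_surjective).symm

theorem canonicalBidual_pointEval (f : Hinf ν) (z : disc) :
    canonicalBidual ν f (pointEval ν z) = f z := by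
  rw [← bidualToHinf_apply]
  exact congrArg (fun h : Hinf ν => h z) ((canonicalBidual ν).symm_apply_apply f)

theorem tendsto_canonicalBidual (f : Hinf ν) (l : StrongDual ℂ (H0 ν)) :
    Tendsto (fun n => l (dilation ν (radius n) f)) atTop (𝓝 (canonicalBidual ν f l)) := by
  obtain ⟨x, -, hxz, hx⟩ := exists_bidual f
  have : canonicalBidual ν f = x := by
    rw [← sub_eq_zero]
    refine bidual_eq_zero fun z => ?_
    rw [sub_apply, canonicalBidual_pointEval, hxz, sub_self]
  rw [this]
  exact hx l

/-- On $H^0_\nu$ the dilates converge weakly to `f` itself. -/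
theorem canonicalBidual_coe (f : H0 ν) :
    canonicalBidual ν f = NormedSpace.inclusionInDoubleDual ℂ (H0 ν) f :=
  ContinuousLinearMap.ext fun l =>
    tendsto_nhds_unique (tendsto_canonicalBidual (f : Hinf ν) l) (tendsto_functional_dilation l f)

instance : CompleteSpace (Hinf ν) :=
  (canonicalBidual ν).toIsometryEquiv.completeSpace_iff.mpr inferInstance

end VolterraComp

end

/-! ### Volterra integrals, and growth from the derivative -/

noncomputable section

set_option maxSynthPendingDepth 3

namespace VolterraComp

section Integral

variable {g φ f : ℂ → ℂ}

theorem differentiableOn_volterra_integrand (hg : DifferentiableOn ℂ g disc)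
    (hφ : DifferentiableOn ℂ φ disc) (hφ_maps : MapsTo φ disc disc)
    (hf : DifferentiableOn ℂ f disc) :
    DifferentiableOn ℂ (fun z => deriv f (φ z) * g z) disc :=
  ((hf.deriv isOpen_ball).comp hφ hφ_maps).mul hg

theorem segment_mem_disc {z : ℂ} (hz : z ∈ disc) {t : ℝ} (ht : t ∈ Icc (0 : ℝ) 1) :
    (t : ℂ) * z ∈ disc := by
  rw [mem_disc, norm_mul, Complex.norm_real, Real.norm_of_nonneg ht.1]
  exact (mul_le_of_le_one_left (norm_nonneg _) ht.2).trans_lt (mem_disc.mp hz)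

/-- The integrand has a primitive on the disc, and the segment integral is its increment from `0`.
-/
theorem hasDerivAt_volterraS (hg : DifferentiableOn ℂ g disc)
    (hφ : DifferentiableOn ℂ φ disc) (hφ_maps : MapsTo φ disc disc)
    (hf : DifferentiableOn ℂ f disc) {z : ℂ} (hz : z ∈ disc) :
    HasDerivAt (volterraS g φ f) (deriv f (φ z) * g z) z := by
  have hk := differentiableOn_volterra_integrand hg hφ hφ_maps hf
  obtain ⟨P, hP⟩ := hk.isExactOn_ball
  have heq : ∀ w ∈ disc, volterraS g φ f w = P w - P 0 := fun w hw => by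
    have hseg : ∀ t ∈ uIcc (0 : ℝ) 1, (t : ℂ) * w ∈ disc := fun t ht =>
      segment_mem_disc hw (by rwa [uIcc_of_le zero_le_one] at ht)
    have hd : ∀ t ∈ uIcc (0 : ℝ) 1, HasDerivAt (fun t : ℝ => P (t * w))
        (w * (deriv f (φ (t * w)) * g (t * w))) t := fun t ht => by
      have h1 : HasDerivAt (fun t : ℝ => (t : ℂ) * w) w t := by
        simpa using (Complex.ofRealCLM.hasDerivAt (x := t)).mul_const w
      have h2 := (hP _ (hseg t ht)).comp t h1
      rwa [mul_comm] at h2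
    have hcont : ContinuousOn (fun t : ℝ => w * (deriv f (φ (t * w)) * g (t * w)))
        (uIcc (0 : ℝ) 1) := by
      refine continuousOn_const.mul (hk.continuousOn.comp (t := disc)
        (f := fun t : ℝ => (t : ℂ) * w) ?_ hseg)
      fun_prop
    have h := intervalIntegral.integral_eq_sub_of_hasDerivAt hd hcont.intervalIntegrable
    simpa [volterraS] using h
  refine ((hP z hz).sub_const (P 0)).congr_of_eventuallyEq ?_
  filter_upwards [isOpen_ball.mem_nhds hz] with w hw using heq w hw

theorem differentiableOn_volterraS (hg : DifferentiableOn ℂ g disc)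
    (hφ : DifferentiableOn ℂ φ disc) (hφ_maps : MapsTo φ disc disc)
    (hf : DifferentiableOn ℂ f disc) : DifferentiableOn ℂ (volterraS g φ f) disc :=
  fun _ hz => (hasDerivAt_volterraS hg hφ hφ_maps hf hz).differentiableAt.differentiableWithinAt

end Integral

variable {ν μ : NormalWeight}

theorem deriv_dilation (r : Ico (0 : ℝ) 1) (f : Hinf ν) {w : ℂ} (hw : w ∈ disc) :
    deriv (dilation ν r f : Hinf ν) w = (r : ℝ) * deriv f ((r : ℝ) * w) := by
  have h1 : (dilation ν r f : Hinf ν).1 =ᶠ[𝓝 w] fun z => f ((r : ℝ) * z) := by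
    filter_upwards [isOpen_ball.mem_nhds hw] with z hz using dilation_apply r f hz
  rw [h1.deriv_eq, deriv_comp_mul_left, smul_eq_mul]

theorem tendsto_deriv_dilation (f : Hinf ν) {w : ℂ} (hw : w ∈ disc) :
    Tendsto (fun n => deriv (dilation ν (radius n) f : Hinf ν) w) atTop (𝓝 (deriv f w)) := by
  have hc : ContinuousAt (deriv f) (1 * w) := by
    rw [one_mul]
    exact ((f.differentiableOn.deriv isOpen_ball).differentiableAt
      (isOpen_ball.mem_nhds hw)).continuousAt
  have h0 : Tendsto (fun n => ((radius n : ℝ) : ℂ)) atTop (𝓝 1) :=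
    (Complex.continuous_ofReal.tendsto 1).comp tendsto_radius
  have h2 := h0.mul (hc.tendsto.comp (h0.mul_const w))
  rw [one_mul, one_mul] at h2
  exact h2.congr fun n => (deriv_dilation _ f hw).symm

theorem norm_deriv_dilation_le (r : Ico (0 : ℝ) 1) (f : Hinf ν) :
    ∃ B : ℝ, ∀ w ∈ disc, ‖deriv (dilation ν r f : Hinf ν) w‖ ≤ B := by
  refine ⟨‖f‖ / ν ((1 + r) / 2 : ℝ) / ((1 - r) / 2), fun w hw => ?_⟩
  rw [deriv_dilation r f hw, norm_mul, Complex.norm_real, Real.norm_of_nonneg r.2.1]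
  exact (mul_le_of_le_one_left (norm_nonneg _) r.2.2.le).trans
    (f.norm_deriv_le r.2.2 (dilate_mem r.2 hw).2.1)

/-- The image under `φ` of the segment from `0` to `z` lies in a disc of radius `R < 1`, where
Cauchy estimates bound the derivatives of all dilates at once. Dominated convergence applies. -/
theorem tendsto_volterraS_dilation {g φ : ℂ → ℂ} (hg : DifferentiableOn ℂ g disc)
    (hφ : DifferentiableOn ℂ φ disc) (hφ_maps : MapsTo φ disc disc) (f : Hinf ν) {z : ℂ}
    (hz : z ∈ disc) :
    Tendsto (fun n => volterraS g φ (dilation ν (radius n) f : Hinf ν) z) atTop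
      (𝓝 (volterraS g φ f z)) := by
  have hsegc : ContinuousOn (fun t : ℝ => (t : ℂ) * z) (Icc 0 1) := by fun_prop
  have hseg : MapsTo (fun t : ℝ => (t : ℂ) * z) (Icc 0 1) disc :=
    fun t ht => segment_mem_disc hz ht
  have hφc : ContinuousOn (fun t : ℝ => ‖φ (t * z)‖) (Icc 0 1) :=
    (hφ.continuousOn.comp hsegc hseg).norm
  have hgc : ContinuousOn (fun t : ℝ => ‖g (t * z)‖) (Icc 0 1) :=
    (hg.continuousOn.comp hsegc hseg).norm
  obtain ⟨t₀, ht₀, hmax⟩ := isCompact_Icc.exists_isMaxOn ⟨0, by simp⟩ hφc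
  have hR : ‖φ (t₀ * z)‖ < 1 := mem_disc.mp (hφ_maps (hseg ht₀))
  have hR0 := norm_nonneg (φ (t₀ * z))
  have hφR : ∀ t ∈ Icc (0 : ℝ) 1, ‖φ (t * z)‖ ≤ ‖φ (t₀ * z)‖ := fun t ht => hmax ht
  generalize ‖φ (t₀ * z)‖ = R at hφR hR hR0
  have hν := ν.pos_ofReal (r := (1 + R) / 2) (by linarith) (by linarith)
  let B : ℝ := ‖f‖ / ν ((1 + R) / 2 : ℝ) / ((1 - R) / 2)
  have hI : ∀ t ∈ uIoc (0 : ℝ) 1, t ∈ Icc (0 : ℝ) 1 := fun t ht => by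
    rw [uIoc_of_le zero_le_one] at ht
    exact ⟨ht.1.le, ht.2⟩
  refine intervalIntegral.tendsto_integral_filter_of_dominated_convergence
    (fun t => ‖z‖ * (B * ‖g (t * z)‖)) (Eventually.of_forall fun n => ?_)
    (Eventually.of_forall fun n => Eventually.of_forall fun t ht => ?_) ?_
    (Eventually.of_forall fun t ht => ?_)
  · have hk := (differentiableOn_volterra_integrand hg hφ hφ_maps
      (dilation ν (radius n) f : Hinf ν).differentiableOn).continuousOn.comp hsegc hseg
    exact ((continuousOn_const.mul hk).mono hI).aestronglyMeasurable measurableSet_uIoc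
  · rw [norm_mul, norm_mul]
    have h1 := (dilation ν (radius n) f : Hinf ν).norm_deriv_le hR (hφR t (hI t ht))
    have h2 : ‖(dilation ν (radius n) f : Hinf ν)‖ ≤ ‖f‖ := norm_dilation_le _ f
    have h3 : (0 : ℝ) < (1 - R) / 2 := by linarith
    have h4 : ‖deriv (dilation ν (radius n) f : Hinf ν) (φ (t * z))‖ ≤ B :=
      h1.trans (by simp only [B]; gcongr)
    gcongr
  · refine ContinuousOn.intervalIntegrable ?_
    rw [uIcc_of_le zero_le_one]
    exact continuousOn_const.mul (continuousOn_const.mul hgc)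
  · exact ((tendsto_deriv_dilation f (hφ_maps (hseg (hI t ht)))).mul_const _).const_mul z

theorem NormalWeight.exists_le_rpow (μ : NormalWeight) : ∃ γ C : ℝ, 0 < γ ∧ 0 < C ∧
    ∀ t s : ℝ, 0 ≤ t → t ≤ s → s < 1 → μ s * (1 - t) ^ γ ≤ C * μ t * (1 - s) ^ γ := by
  obtain ⟨γ, hγ, C, hC, h⟩ := μ.normal_II
  refine ⟨γ, C * 2 ^ γ, hγ, by positivity, fun t s ht hts hs => ?_⟩
  have h1 := h t s ht hts hs
  have hs2 : 0 < 1 - s ^ 2 := by nlinarith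
  have ht2 : 0 < 1 - t ^ 2 := by nlinarith
  have hμs := μ.pos_ofReal (ht.trans hts) hs
  have hμt := μ.pos_ofReal ht (hts.trans_lt hs)
  have h3 : (1 - t) ^ γ ≤ (1 - t ^ 2) ^ γ :=
    Real.rpow_le_rpow (by linarith) (by nlinarith) hγ.le
  have h4 : (1 - s ^ 2) ^ γ ≤ 2 ^ γ * (1 - s) ^ γ := by
    rw [← Real.mul_rpow (by norm_num) (by linarith)]
    exact Real.rpow_le_rpow hs2.le (by nlinarith) hγ.le
  rw [← mul_div_assoc, div_le_div_iff₀ (Real.rpow_pos_of_pos hs2 _)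
    (Real.rpow_pos_of_pos ht2 _)] at h1
  calc μ s * (1 - t) ^ γ ≤ μ s * (1 - t ^ 2) ^ γ := mul_le_mul_of_nonneg_left h3 hμs.le
    _ ≤ C * μ t * (1 - s ^ 2) ^ γ := h1
    _ ≤ C * μ t * (2 ^ γ * (1 - s) ^ γ) := mul_le_mul_of_nonneg_left h4 (by positivity)
    _ = _ := by ring

/-- Integrate along the radius through `z`. The derivative bound is needed only for `‖w‖ < ‖z‖`, so
`K` may depend on `z`. -/
theorem norm_le_of_norm_deriv_le_rpow {h : ℂ → ℂ} (hh : DifferentiableOn ℂ h disc) {γ K B R : ℝ}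
    (hγ : 0 < γ) (hK : 0 ≤ K) (hR : 0 ≤ R) {z : ℂ} (hz : z ∈ disc) (hRz : R < ‖z‖)
    (hB : ∀ w : ℂ, ‖w‖ ≤ R → ‖h w‖ ≤ B)
    (hd : ∀ w : ℂ, R ≤ ‖w‖ → ‖w‖ < ‖z‖ → ‖deriv h w‖ ≤ K * (1 - ‖w‖) ^ (-γ - 1)) :
    ‖h z‖ ≤ B + K / γ * (1 - ‖z‖) ^ (-γ) := by
  have hz1 := mem_disc.mp hz
  have hz0 : 0 < ‖z‖ := hR.trans_lt hRz
  let e : ℂ := z / ‖z‖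
  have he : ‖e‖ = 1 := by
    rw [norm_div, Complex.norm_real, norm_norm, div_self hz0.ne']
  have hnorm : ∀ t : ℝ, 0 ≤ t → ‖(t : ℂ) * e‖ = t := fun t ht => by
    rw [norm_mul, he, Complex.norm_real, Real.norm_of_nonneg ht, mul_one]
  have hder : ∀ t : ℝ, 0 ≤ t → t < 1 →
      HasDerivAt (fun t : ℝ => h (t * e)) (deriv h (t * e) * e) t := fun t ht ht1 => by
    have hmem : (t : ℂ) * e ∈ disc := by rw [mem_disc, hnorm t ht]; exact ht1
    have h1 : HasDerivAt (fun t : ℝ => (t : ℂ) * e) e t := by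
      simpa using (Complex.ofRealCLM.hasDerivAt (x := t)).mul_const e
    exact (hh.differentiableAt (isOpen_ball.mem_nhds hmem)).hasDerivAt.comp t h1
  have hBder : ∀ t : ℝ, t < 1 → HasDerivAt (fun t : ℝ => B + K / γ * (1 - t) ^ (-γ))
      (K * (1 - t) ^ (-γ - 1)) t := fun t ht => by
    have h1 : HasDerivAt (fun t : ℝ => 1 - t) (-1) t := (hasDerivAt_id t).const_sub 1
    have h2 := ((h1.rpow_const (p := -γ) (Or.inl (by linarith))).const_mul (K / γ)).const_add B
    refine h2.congr_deriv ?_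
    rw [neg_mul_neg, one_mul, ← mul_assoc, div_mul_cancel₀ _ hγ.ne']
  have hB0 : ‖h ((R : ℝ) * e)‖ ≤ B + K / γ * (1 - R) ^ (-γ) := by
    have h1 := hB _ (hnorm R hR).le
    have h2 : 0 ≤ K / γ * (1 - R) ^ (-γ) :=
      mul_nonneg (by positivity) (Real.rpow_nonneg (by linarith) _)
    linarith
  have hfin := image_norm_le_of_norm_deriv_right_le_deriv_boundary' (a := R) (b := ‖z‖)
    (fun t ht => (hder t (hR.trans ht.1) (ht.2.trans_lt hz1)).continuousAt.continuousWithinAt)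
    (fun t ht => (hder t (hR.trans ht.1) (ht.2.trans hz1)).hasDerivWithinAt)
    hB0
    (fun t ht => (hBder t (ht.2.trans_lt hz1)).continuousAt.continuousWithinAt)
    (fun t ht => (hBder t (ht.2.trans hz1)).hasDerivWithinAt)
    (fun t ht => by
      have ht0 := hnorm t (hR.trans ht.1)
      have h1 := hd (t * e) (by rw [ht0]; exact ht.1) (by rw [ht0]; exact ht.2)
      rw [ht0] at h1
      rw [norm_mul, he, mul_one]
      exact h1)
    (x := ‖z‖) ⟨hRz.le, le_rfl⟩
  have hze : ((‖z‖ : ℝ) : ℂ) * e = z := by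
    have : ((‖z‖ : ℝ) : ℂ) ≠ 0 := by exact_mod_cast hz0.ne'
    simp only [e]
    field_simp
  rwa [hze] at hfin

/-- For a normal weight, little-o growth of the derivative implies little-o growth of the
function. -/
theorem vanishesAtBoundary_of_deriv (μ : NormalWeight) {h : ℂ → ℂ}
    (hh : DifferentiableOn ℂ h disc)
    (hd : VanishesAtBoundary (fun z => (1 - ‖z‖ ^ 2) * μ z) (deriv h)) :
    VanishesAtBoundary μ h := by
  obtain ⟨γ, C, hγ, hC, hμ⟩ := μ.exists_le_rpow
  have hw : ∀ z ∈ disc, 0 ≤ (1 - ‖z‖ ^ 2) * μ z := fun z hz =>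
    mul_nonneg (by nlinarith [mem_disc.mp hz, norm_nonneg z]) (μ.pos z hz).le
  rw [vanishesAtBoundary_iff hw] at hd
  refine (vanishesAtBoundary_iff fun z hz => (μ.pos z hz).le).mpr fun ε hε => ?_
  let δ : ℝ := ε / 2 * (γ / C)
  have hδ : 0 < δ := by positivity
  obtain ⟨R₀, hR₀, hR₀1, hdR⟩ := hd δ hδ
  -- The derivative bound holds strictly beyond `R₀`, while the integration needs it at the initial
  -- radius too.
  obtain ⟨R, hR₀R, hR1⟩ := exists_between hR₀1
  have hR : 0 ≤ R := hR₀.trans hR₀R.le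
  obtain ⟨B, hB⟩ := (isCompact_closedBall (0 : ℂ) R).exists_bound_of_continuousOn
    (hh.continuousOn.mono (closedBall_subset_ball hR1))
  have hB0 : 0 ≤ B := (norm_nonneg _).trans (hB 0 (by simpa using hR))
  obtain ⟨R', hR', hR'1, hμR⟩ := (vanishesAtBoundary_iff fun z hz => (μ.pos z hz).le).mp
    (vanishesAtBoundary_of_bounded μ (f := fun _ => (B : ℂ)) fun _ _ => le_rfl) (ε / 2)
    (by positivity)
  refine ⟨max R R', le_max_of_le_left hR, max_lt hR1 hR'1, fun z hz hzR => ?_⟩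
  obtain ⟨hzR, hzR'⟩ := max_lt_iff.mp hzR
  have hz1 := mem_disc.mp hz
  have hμz := μ.pos z hz
  have hs : 0 < 1 - ‖z‖ := by linarith
  have hsγ := Real.rpow_pos_of_pos hs γ
  -- This `K` comes from comparing `μ w` with `μ z` by the almost decreasing condition. Its factor
  -- `(1 - ‖z‖) ^ γ` cancels the power produced by integration, leaving `δ * C / γ = ε / 2`.
  have hmain := norm_le_of_norm_deriv_le_rpow hh hγ (K := δ * C * (1 - ‖z‖) ^ γ / μ z)
    (B := B) (by positivity) hR hz hzR (fun w hw => hB w (by simpa using hw)) (fun w hRw hwz => by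
      have hw1 : w ∈ disc := mem_disc.mpr (hwz.trans hz1)
      have hμw := μ.pos w hw1
      have ht : 0 < 1 - ‖w‖ := by linarith
      have h1 := hdR w hw1 (hR₀R.trans_le hRw)
      have h2 := hμ ‖w‖ ‖z‖ (norm_nonneg _) hwz.le hz1
      rw [← μ.radial z hz, ← μ.radial w hw1] at h2
      have htγ := Real.rpow_pos_of_pos ht γ
      have h3 : (1 - ‖w‖) * μ w * ‖deriv h w‖ ≤ δ := by
        refine le_trans ?_ h1
        gcongr
        nlinarith [norm_nonneg w]
      have hpow : (1 - ‖w‖) ^ (-γ - 1) = ((1 - ‖w‖) ^ γ * (1 - ‖w‖))⁻¹ := by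
        rw [← Real.rpow_add_one ht.ne', ← Real.rpow_neg ht.le]
        congr 1
        ring
      rw [hpow, ← div_eq_mul_inv, div_div, le_div_iff₀ (by positivity)]
      calc ‖deriv h w‖ * (μ z * ((1 - ‖w‖) ^ γ * (1 - ‖w‖)))
          = ‖deriv h w‖ * (1 - ‖w‖) * (μ z * (1 - ‖w‖) ^ γ) := by ring
        _ ≤ ‖deriv h w‖ * (1 - ‖w‖) * (C * μ w * (1 - ‖z‖) ^ γ) := by gcongr
        _ = (1 - ‖w‖) * μ w * ‖deriv h w‖ * (C * (1 - ‖z‖) ^ γ) := by ring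
        _ ≤ δ * (C * (1 - ‖z‖) ^ γ) := by gcongr
        _ = _ := by ring)
  have h5 := hμR z hz hzR'
  rw [Complex.norm_real, Real.norm_of_nonneg hB0] at h5
  have h6 : μ z * (δ * C * (1 - ‖z‖) ^ γ / μ z / γ * (1 - ‖z‖) ^ (-γ)) = ε / 2 := by
    rw [Real.rpow_neg hs.le]
    simp only [δ]
    field_simp
  calc μ z * ‖h z‖ ≤ μ z * (B + δ * C * (1 - ‖z‖) ^ γ / μ z / γ * (1 - ‖z‖) ^ (-γ)) :=
        mul_le_mul_of_nonneg_left hmain hμz.le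
    _ ≤ ε := by rw [mul_add, h6]; linarith

theorem isClosed_H0 : IsClosed (H0 μ : Set (Hinf μ)) := by
  refine isClosed_of_closure_subset fun f hf => ?_
  have hpos : ∀ z ∈ disc, 0 ≤ μ z := fun z hz => (μ.pos z hz).le
  refine (vanishesAtBoundary_iff hpos).mpr fun ε hε => ?_
  obtain ⟨h, hh, hfh⟩ := Metric.mem_closure_iff.mp hf (ε / 2) (by positivity)
  obtain ⟨R, hR0, hR1, hR⟩ := (vanishesAtBoundary_iff hpos).mp hh (ε / 2) (by positivity)
  refine ⟨R, hR0, hR1, fun z hz hRz => ?_⟩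
  have h1 := hR z hz hRz
  have h2 := (f - h).le_norm hz
  rw [dist_eq_norm] at hfh
  have h3 : ‖f z‖ ≤ ‖(f - h) z‖ + ‖h z‖ := by
    rw [Hinf.sub_apply]
    exact norm_le_norm_sub_add _ _
  have h4 := mul_le_mul_of_nonneg_left h3 (hpos z hz)
  rw [mul_add] at h4
  linarith

instance : CompleteSpace (H0 μ) := isClosed_H0.completeSpace_coe

theorem tendsto_apply_of_tendsto {ι : Type*} {l : Filter ι} {u : ι → Hinf μ} {h : Hinf μ}
    (hu : Tendsto u l (𝓝 h)) {z : ℂ} (hz : z ∈ disc) :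
    Tendsto (fun i => u i z) l (𝓝 (h z)) := by
  rw [tendsto_iff_norm_sub_tendsto_zero] at hu ⊢
  have h1 := hu.mul_const (μ z)⁻¹
  rw [zero_mul] at h1
  refine squeeze_zero (fun _ => norm_nonneg _) (fun i => ?_) h1
  have h2 := (u i - h).le_norm hz
  rw [Hinf.sub_apply] at h2
  rw [← div_eq_mul_inv, le_div_iff₀ (μ.pos z hz), mul_comm]
  exact h2

/-- On `H^0_ν` the dilations converge strongly to the identity. -/
theorem tendsto_dilation (f : H0 ν) :
    Tendsto (fun n => dilation ν (radius n) f) atTop (𝓝 f) := by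
  rw [Metric.tendsto_nhds]
  intro ε hε
  have hpos : ∀ z ∈ disc, 0 ≤ ν z := fun z hz => (ν.pos z hz).le
  have hν0 := ν.pos 0 (by simp)
  obtain ⟨R, hR0, hR1, hR⟩ := (vanishesAtBoundary_iff hpos).mp f.2 (ε / 4) (by positivity)
  -- With `R' > R`, both `z` and its dilate eventually lie beyond `R` whenever `‖z‖ > R'`; the
  -- remaining points are handled by the mean value bound.
  obtain ⟨R', hRR', hR'1⟩ := exists_between hR1
  have hev1 : ∀ᶠ n in atTop, R < (radius n : ℝ) * R' := by
    have h := tendsto_radius.mul_const R'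
    rw [one_mul] at h
    exact h.eventually_const_lt hRR'
  let A : ℝ := ‖(f : Hinf ν)‖ / ν ((1 + R') / 2 : ℝ) / ((1 - R') / 2)
  have hev2 : ∀ᶠ n in atTop, ν 0 * (A * (1 - (radius n : ℝ))) ≤ ε / 2 := by
    have h := ((tendsto_radius.const_sub 1).const_mul A).const_mul (ν 0)
    simp only [sub_self, mul_zero] at h
    exact h.eventually_le_const (by positivity)
  filter_upwards [hev1, hev2] with n h1 h2
  rw [dist_eq_norm]
  refine (H0.norm_le fun z hz => ?_).trans_lt (half_lt_self hε)
  rw [Submodule.coe_sub, Hinf.sub_apply, dilation_apply _ _ hz, norm_sub_rev]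
  by_cases hzR : ‖z‖ ≤ R'
  · have h3 := (f : Hinf ν).norm_sub_dilate_le hR'1 (radius n) hzR
    refine le_trans ?_ h2
    exact mul_le_mul (ν.le_zero hz) h3 (norm_nonneg _) hν0.le
  · rw [not_le] at hzR
    have hmem := dilate_mem (radius n).2 hz
    have h3 := hR z hz (hRR'.trans hzR)
    have h4 := hR _ hmem.1 (by
      rw [norm_mul, Complex.norm_real, Real.norm_of_nonneg (radius n).2.1]
      exact h1.trans_le (mul_le_mul_of_nonneg_left hzR.le (radius n).2.1))
    have h5 := mul_le_mul_of_nonneg_right (ν.le_of_norm_le hz hmem.2.2)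
      (norm_nonneg ((f : Hinf ν) ((radius n : ℝ) * z)))
    have h6 := mul_le_mul_of_nonneg_left
      (norm_sub_le ((f : Hinf ν) z) ((f : Hinf ν) ((radius n : ℝ) * z))) (hpos z hz)
    rw [mul_add] at h6
    linarith

end VolterraComp

end

/-! ### The bi-transpose of $S_g^\phi$ and compactness -/

noncomputable section

set_option maxSynthPendingDepth 3

namespace VolterraComp

variable {ν μ : NormalWeight} {g φ : ℂ → ℂ}

/-- A compact `S_g^φ` extends to `H^∞_ν`, and the extension is given by the bi-transpose. -/
theorem exists_eqOn_volterraS_of_isCompactOperator (hg : DifferentiableOn ℂ g disc)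
    (hφ : DifferentiableOn ℂ φ disc) (hφ_maps : MapsTo φ disc disc) {S : H0 ν →L[ℂ] Hinf μ}
    (hS : ∀ f : H0 ν, EqOn (S f) (volterraS g φ (f : Hinf ν)) disc) (hc : IsCompactOperator S)
    (f : Hinf ν) :
    ∃ h ∈ closure (range S), EqOn h (volterraS g φ f) disc ∧
      bitranspose S (canonicalBidual ν f) = NormedSpace.inclusionInDoubleDual ℂ (Hinf μ) h := by
  obtain ⟨K, hK, hSK⟩ := IsCompactOperator.image_closedBall_subset_compact
    (f := (S : H0 ν →ₗ[ℂ] Hinf μ)) hc ‖f‖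
  -- Compactness gives a norm limit of the images of dilates along a subsequence. Point values
  -- identify it with $S_g^\phi f$, functionals identify it with the bi-transpose.
  obtain ⟨h, -, τ, hτ, hlim⟩ := hK.tendsto_subseq
    (x := fun n => S (dilation ν (radius n) f)) fun n =>
      hSK ⟨_, mem_closedBall_zero_iff.mpr (norm_dilation_le _ f), rfl⟩
  refine ⟨h, mem_closure_of_tendsto hlim (Eventually.of_forall fun n => mem_range_self _),
    fun z hz => ?_, ContinuousLinearMap.ext fun l => ?_⟩
  · refine tendsto_nhds_unique (tendsto_apply_of_tendsto hlim hz) ?_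
    refine ((tendsto_volterraS_dilation hg hφ hφ_maps f hz).comp hτ.tendsto_atTop).congr fun n => ?_
    exact (hS _ hz).symm
  · refine tendsto_nhds_unique
      ((tendsto_canonicalBidual f (transpose S l)).comp hτ.tendsto_atTop) ?_
    exact (l.continuous.tendsto h).comp hlim

/-- A dilate has bounded derivative, so the derivative of its image is a bounded multiple of `g` and
the image lies in $H^0_\mu$. Strong convergence of dilations and closedness of $H^0_\mu$ give the
general case. -/
theorem volterraS_mem_H0 (hg : DifferentiableOn ℂ g disc)
    (hφ : DifferentiableOn ℂ φ disc) (hφ_maps : MapsTo φ disc disc) {S : H0 ν →L[ℂ] Hinf μ}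
    (hS : ∀ f : H0 ν, EqOn (S f) (volterraS g φ (f : Hinf ν)) disc)
    (hg0 : VanishesAtBoundary (fun z => (1 - ‖z‖ ^ 2) * μ z) g) (f : H0 ν) : S f ∈ H0 μ := by
  have hw : ∀ z ∈ disc, 0 ≤ (1 - ‖z‖ ^ 2) * μ z := fun z hz =>
    mul_nonneg (by nlinarith [mem_disc.mp hz, norm_nonneg z]) (μ.pos z hz).le
  refine isClosed_H0.mem_of_tendsto ((S.continuous.tendsto f).comp (tendsto_dilation f))
    (Eventually.of_forall fun n => ?_)
  have hd := (dilation ν (radius n) f : Hinf ν).differentiableOn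
  obtain ⟨B, hB⟩ := norm_deriv_dilation_le (radius n) (f : Hinf ν)
  have hvan : VanishesAtBoundary (fun z => (1 - ‖z‖ ^ 2) * μ z)
      (deriv (volterraS g φ (dilation ν (radius n) f : Hinf ν))) := by
    have hlim := Tendsto.const_mul B (show Tendsto _ _ _ from hg0)
    rw [mul_zero] at hlim
    refine squeeze_zero' ?_ ?_ hlim
    · refine eventually_boundary_iff.mpr ⟨0, le_rfl, by norm_num, fun z hz _ => ?_⟩
      exact mul_nonneg (hw z hz) (norm_nonneg _)
    · refine eventually_boundary_iff.mpr ⟨0, le_rfl, by norm_num, fun z hz _ => ?_⟩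
      rw [(hasDerivAt_volterraS hg hφ hφ_maps hd hz).deriv, norm_mul, mul_left_comm]
      exact mul_le_mul_of_nonneg_right (hB _ (hφ_maps hz))
        (mul_nonneg (hw z hz) (norm_nonneg _))
  exact (vanishesAtBoundary_of_deriv μ (differentiableOn_volterraS hg hφ hφ_maps hd) hvan).congr
    (hS (dilation ν (radius n) f)).symm

/-- The bi-transpose of `S_g^φ : H^0_ν → H^0_μ` is `S_g^φ` on `H^∞_ν`. -/
theorem exists_bitranspose_eq_canonicalBidual (hg : DifferentiableOn ℂ g disc)
    (hφ : DifferentiableOn ℂ φ disc) (hφ_maps : MapsTo φ disc disc) {S : H0 ν →L[ℂ] H0 μ}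
    (hS : ∀ f : H0 ν, EqOn (S f : Hinf μ) (volterraS g φ (f : Hinf ν)) disc) (f : Hinf ν) :
    ∃ h : Hinf μ, EqOn h (volterraS g φ f) disc ∧
      bitranspose S (canonicalBidual ν f) = canonicalBidual μ h := by
  obtain ⟨h, hh⟩ := (canonicalBidual μ).surjective (bitranspose S (canonicalBidual ν f))
  refine ⟨h, fun z hz => ?_, hh.symm⟩
  have h1 := canonicalBidual_pointEval h ⟨z, hz⟩
  rw [hh, bitranspose_apply] at h1
  refine h1.symm.trans ?_
  refine tendsto_nhds_unique (tendsto_canonicalBidual f (transpose S (pointEval μ ⟨z, hz⟩))) ?_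
  exact (tendsto_volterraS_dilation hg hφ hφ_maps f hz).congr fun n => (hS _ hz).symm

theorem tfae_volterraS (hg : DifferentiableOn ℂ g disc)
    (hφ : DifferentiableOn ℂ φ disc) (hφ_maps : MapsTo φ disc disc) {S : H0 ν →L[ℂ] Hinf μ}
    (hS : ∀ f : H0 ν, EqOn (S f) (volterraS g φ (f : Hinf ν)) disc) :
    List.TFAE
      [IsCompactOperator S,
       IsWeaklyCompactOperator S,
       ∀ f : Hinf ν, ∃ h : Hinf μ, EqOn h (volterraS g φ f) disc ∧
        bitranspose S (canonicalBidual ν f) =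
          NormedSpace.inclusionInDoubleDual ℂ (Hinf μ) h] := by
  tfae_have 1 → 2 := isWeaklyCompactOperator_of_isCompactOperator
  tfae_have 2 → 1 := fun h => h.isCompactOperator
  tfae_have 1 → 3 := fun hc f => by
    obtain ⟨h, -, hh⟩ := exists_eqOn_volterraS_of_isCompactOperator hg hφ hφ_maps hS hc f
    exact ⟨h, hh⟩
  tfae_have 3 → 2 := fun h => isWeaklyCompactOperator_of_bitranspose_mem_range fun x => by
    obtain ⟨f, rfl⟩ := (canonicalBidual ν).surjective x
    obtain ⟨y, -, hy⟩ := h f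
    exact ⟨y, hy.symm⟩
  tfae_finish

/-- If `S` is compact, $S_g^\phi f$ is represented in the closure of the range, inside the closed
subspace $H^0_\mu$. Conversely, when the images lie in $H^0_\mu$ the bi-transpose takes values in
its canonical copy, so `S` is weakly compact and hence compact. -/
theorem isCompactOperator_iff_forall_memH0 (hg : DifferentiableOn ℂ g disc)
    (hφ : DifferentiableOn ℂ φ disc) (hφ_maps : MapsTo φ disc disc) {S : H0 ν →L[ℂ] H0 μ}
    (hS : ∀ f : H0 ν, EqOn (S f : Hinf μ) (volterraS g φ (f : Hinf ν)) disc) :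
    IsCompactOperator S ↔ ∀ f : Hinf ν, MemH0 μ (volterraS g φ f) := by
  constructor
  · intro hc f
    have hc' : IsCompactOperator ((H0 μ).subtypeL.comp S) := hc.clm_comp (H0 μ).subtypeL
    obtain ⟨h, hcl, hh, -⟩ := exists_eqOn_volterraS_of_isCompactOperator hg hφ hφ_maps
      (S := (H0 μ).subtypeL.comp S) hS hc' f
    have hmem : h ∈ H0 μ := closure_minimal (by
      rintro _ ⟨x, rfl⟩
      exact (S x).2) isClosed_H0 hcl
    exact ⟨differentiableOn_volterraS hg hφ hφ_maps f.differentiableOn,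
      VanishesAtBoundary.congr hmem hh⟩
  · intro hmem
    refine IsWeaklyCompactOperator.isCompactOperator
      (isWeaklyCompactOperator_of_bitranspose_mem_range fun x => ?_)
    obtain ⟨f, rfl⟩ := (canonicalBidual ν).surjective x
    obtain ⟨h, hh, hbi⟩ := exists_bitranspose_eq_canonicalBidual hg hφ hφ_maps hS f
    have hh0 : h ∈ H0 μ := (hmem f).2.congr hh.symm
    exact ⟨⟨h, hh0⟩, (hbi.trans (canonicalBidual_coe ⟨h, hh0⟩)).symm⟩

/-- The canonical identification as a continuous linear equivalence. -/
def canonicalBidualEquiv (ν : NormalWeight) :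
    Hinf ν ≃L[ℂ] StrongDual ℂ (StrongDual ℂ (H0 ν)) :=
  (canonicalBidual ν).toContinuousLinearEquiv

theorem isCanonicalBidual_canonicalBidualEquiv (ν : NormalWeight) :
    IsCanonicalBidual (canonicalBidualEquiv ν) :=
  canonicalBidual_pointEval

end VolterraComp

end

theorem mainTheorem8 (ν μ : VolterraComp.NormalWeight) (g φ : ℂ → ℂ)
    (hg : DifferentiableOn ℂ g VolterraComp.disc)
    (hφ : DifferentiableOn ℂ φ VolterraComp.disc)
    (hφ_maps : Set.MapsTo φ VolterraComp.disc VolterraComp.disc)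
    -- `S_g^φ : H^0_ν → H^∞_μ` is bounded; `S` denotes this bounded operator
    (S : VolterraComp.H0 ν →L[ℂ] VolterraComp.Hinf μ)
    (hS : ∀ f : VolterraComp.H0 ν,
      Set.EqOn (S f) (VolterraComp.volterraS g φ (f : VolterraComp.Hinf ν)) VolterraComp.disc) :
    -- the canonical identifications with the biduals
    ∃ (Φν : VolterraComp.Hinf ν ≃L[ℂ] StrongDual ℂ (StrongDual ℂ (VolterraComp.H0 ν)))
      (Φμ : VolterraComp.Hinf μ ≃L[ℂ] StrongDual ℂ (StrongDual ℂ (VolterraComp.H0 μ))),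
      VolterraComp.IsCanonicalBidual Φν ∧ VolterraComp.IsCanonicalBidual Φμ ∧
      -- (i)
      List.TFAE
        [IsCompactOperator S,
         VolterraComp.IsWeaklyCompactOperator S,
         ∀ f : VolterraComp.Hinf ν, ∃ h : VolterraComp.Hinf μ,
          Set.EqOn h (VolterraComp.volterraS g φ f) VolterraComp.disc ∧
          VolterraComp.bitranspose S (Φν f) =
            NormedSpace.inclusionInDoubleDual ℂ (VolterraComp.Hinf μ) h] ∧
      -- (ii)
      (VolterraComp.MemH0 (fun z => (1 - ‖z‖ ^ 2) * μ z) g →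
        ∃ S₀ : VolterraComp.H0 ν →L[ℂ] VolterraComp.H0 μ,
          (∀ f : VolterraComp.H0 ν,
            Set.EqOn (S₀ f : VolterraComp.Hinf μ)
              (VolterraComp.volterraS g φ (f : VolterraComp.Hinf ν)) VolterraComp.disc) ∧
          (∀ f : VolterraComp.Hinf ν, ∃ h : VolterraComp.Hinf μ,
            Set.EqOn h (VolterraComp.volterraS g φ f) VolterraComp.disc ∧
            VolterraComp.bitranspose S₀ (Φν f) = Φμ h) ∧
          (IsCompactOperator S₀ ↔
            ∀ f : VolterraComp.Hinf ν,
              VolterraComp.MemH0 μ (VolterraComp.volterraS g φ f))) := by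
  refine ⟨VolterraComp.canonicalBidualEquiv ν, VolterraComp.canonicalBidualEquiv μ,
    VolterraComp.isCanonicalBidual_canonicalBidualEquiv ν,
    VolterraComp.isCanonicalBidual_canonicalBidualEquiv μ,
    VolterraComp.tfae_volterraS hg hφ hφ_maps hS, fun hg0 => ?_⟩
  have hS₀ := VolterraComp.volterraS_mem_H0 hg hφ hφ_maps hS hg0.2
  exact ⟨S.codRestrict (VolterraComp.H0 μ) hS₀, hS,
    VolterraComp.exists_bitranspose_eq_canonicalBidual hg hφ hφ_maps hS,
    VolterraComp.isCompactOperator_iff_forall_memH0 hg hφ hφ_maps hS⟩
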